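/- Let $\Gamma\subset\mathrm{SL}(2,\mathbb{R})$ be a discrete subgroup with $-1\in\Gamma$ such that the hyperbolic surface $\mathcal{Y}=\Gamma\backslash\mathbb{H}$ has finite area and $K\geq 1$ cusps. Identify its unit tangent bundle with $\mathcal{X}=\Gamma\backslash\mathrm{SL}(2,\mathbb{R})$, and let $\mu$ be the normalised Liouville measure, i.e. the probability measure on $\mathcal{X}$ induced by Haar measure on $\mathrm{SL}(2,\mathbb{R})$. Let $$\varphi_t(x)=x\begin{pmatrix}e^{t/2}&0\\0&e^{-t/2}\end{pmatrix},\qquad h^+_s(x)=x\begin{pmatrix}1&0\\-s&1\end{pmatrix},\qquad h^-_s(x)=x\begin{pmatrix}1&s\\0&1\end{pmatrix}$$ be the geodesic, unstable horocycle and stable horocycle flows. For each cusp $\kappa\in[K]=\{1,\dots,K\}$ let $\mathcal{C}_\kappa$ be the closed stable horocycle of length one around the cusp $\kappa$, with vectors pointing towards the cusp, and fix $x_\kappa\in\mathcal{C}_\kappa$. For $\sigma\in\mathbb{R}^K$ and $R\in\mathbb{R}$ set $$\mathcal{H}_\kappa(R)=\bigcup_{t\geq R}\varphi_t(\mathcal{C}_\kappa),\qquad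 \mathcal{H}(\sigma,R)=\bigcup_{\kappa=1}^K\mathcal{H}_\kappa(\sigma_\kappa+R),$$ $$\Sigma^K(\sigma)=\{(s,t,\kappa): s\in[0,1),\ t\geq\sigma_\kappa,\ \kappa\in[K]\},\qquad \iota_{\sigma,R}(s,t,\kappa)=\varphi_{t+R}(h^-_s(x_\kappa)),$$ and let $\nu_\sigma$ be the measure on $\Sigma^K(\sigma)$ given by $e^{-t}\,ds\,dt$ on each sheet $\{\kappa=\mathrm{const}\}$. Let $\xi_1(x,\sigma,R)\in(0,\infty]$ be the first time $r>0$ with $h^+_r(x)\in\mathcal{H}(\sigma,R)$ and, if it is finite, let $(w_1,\kappa_1)(x,\sigma,R)\in\Sigma^K(\sigma)$ be the parameter of the point hit, $\iota_{\sigma,R}(w_1,\kappa_1)=h^+_{\xi_1}(x)$. Let $\eta_1(w,\kappa,\sigma)$ and $\eta_{-1}(w,\kappa,\sigma)$ be the first $r>0$ for which $h^+_{r}(\iota_{\sigma,0}(w,\kappa))$, respectively $h^+_{-r}(\iota_{\sigma,0}(w,\kappa))$, lies in $\mathcal{H}(\sigma,0)$, and put $\overline\eta_1(\sigma)=\int_{\Sigma^K(\sigma)}\eta_1\,d\nu_\sigma$.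 Let $\lambda$ be a Borel probability measure on $\mathcal{X}$ that is admissible: $\lim_{t\to\infty}\lambda(\varphi_t\mathcal{E})=\mu(\mathcal{E})$ for every Borel set $\mathcal{E}\subset\mathcal{X}$ with $\mu(\partial\mathcal{E})=0$. Fix $\sigma\in\mathbb{R}^K$. Then $$\Psi_\sigma(r,w,\kappa)=\frac{1}{\overline\eta_1(\sigma)}\,\mathbf{1}\bigl(r<\eta_{-1}(w,\kappa,\sigma)\bigr)$$ is an $L^1$ probability density on $\mathbb{R}_{>0}\times\Sigma^K(\sigma)$ with respect to $dr\otimes\nu_\sigma$, and for every $X>0$ and every Borel set $\mathcal{D}\subset\Sigma^K(\sigma)$ with boundary of Lebesgue measure zero, $$\lim_{R\to\infty}\lambda\bigl\{x_0\in\mathcal{X}: e^{-R}\xi_1(x_0,\sigma,R)>X,\ (w_1,\kappa_1)(x_0,\sigma,R)\in\mathcal{D}\bigr\}=\int_X^\infty\int_{\mathcal{D}}\Psi_\sigma(r,w,\kappa)\,\nu_\sigma(dw,\{\kappa\})\,dr .$$ -/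

import Mathlib

open MeasureTheory Filter Topology Set

noncomputable section

namespace CuspHitting

/-- The group `SL(2, ℝ)`. -/
abbrev SL2R : Type := Matrix.SpecialLinearGroup (Fin 2) ℝ

instance instMeasurableSpaceSL2R : MeasurableSpace SL2R := borel SL2R

instance instBorelSpaceSL2R : BorelSpace SL2R := ⟨rfl⟩

/-- The space `Γ \ SL(2, ℝ)` of cosets `Γ g`. If `Γ` is discrete and contains `-1`, this is the
unit tangent bundle of the hyperbolic surface (orbifold) `Γ \ ℍ`. -/
def CosetSpace (Γ : Subgroup SL2R) : Type := Quotient (QuotientGroup.rightRel Γ)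

/-- The coset `Γ g`. -/
def toCoset (Γ : Subgroup SL2R) (g : SL2R) : CosetSpace Γ :=
  Quotient.mk (QuotientGroup.rightRel Γ) g

/-- The quotient topology. -/
instance instTopologicalSpaceCosetSpace (Γ : Subgroup SL2R) : TopologicalSpace (CosetSpace Γ) :=
  inferInstanceAs (TopologicalSpace (Quotient (QuotientGroup.rightRel Γ)))

/-- The Borel σ-algebra of the quotient topology. -/
instance instMeasurableSpaceCosetSpace (Γ : Subgroup SL2R) : MeasurableSpace (CosetSpace Γ) :=
  borel (CosetSpace Γ)

instance instBorelSpaceCosetSpace (Γ : Subgroup SL2R) : BorelSpace (CosetSpace Γ) := ⟨rfl⟩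

/-- Right translation `Γ g ↦ Γ g a`. -/
def rightTranslate (Γ : Subgroup SL2R) (a : SL2R) : CosetSpace Γ → CosetSpace Γ :=
  Quotient.map (· * a) (by
    intro x y h
    have h' : QuotientGroup.rightRel Γ x y := h
    rw [QuotientGroup.rightRel_apply] at h'
    show QuotientGroup.rightRel Γ (x * a) (y * a)
    rw [QuotientGroup.rightRel_apply]
    simpa [mul_assoc] using h')

/-- The matrix `diag (e^{t/2}, e^{-t/2})`. -/
def diagMatrix (t : ℝ) : SL2R :=
  ⟨!![Real.exp (t / 2), 0; 0, Real.exp (-t / 2)], by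
    rw [Matrix.det_fin_two_of, ← Real.exp_add]; ring_nf; simp⟩

/-- The matrix with rows `(1, s)` and `(0, 1)`. -/
def upperMatrix (s : ℝ) : SL2R := ⟨!![1, s; 0, 1], by simp [Matrix.det_fin_two_of]⟩

/-- The matrix with rows `(1, 0)` and `(-s, 1)`. -/
def lowerMatrix (s : ℝ) : SL2R := ⟨!![1, 0; -s, 1], by simp [Matrix.det_fin_two_of]⟩

/-- The geodesic flow `φ_t`. -/
def geodesicFlow (Γ : Subgroup SL2R) (t : ℝ) : CosetSpace Γ → CosetSpace Γ :=
  rightTranslate Γ (diagMatrix t)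

/-- The unstable horocycle flow `h⁺_s`. -/
def unstableFlow (Γ : Subgroup SL2R) (s : ℝ) : CosetSpace Γ → CosetSpace Γ :=
  rightTranslate Γ (lowerMatrix s)

/-- The stable horocycle flow `h⁻_s`. -/
def stableFlow (Γ : Subgroup SL2R) (s : ℝ) : CosetSpace Γ → CosetSpace Γ :=
  rightTranslate Γ (upperMatrix s)

/-- The measure on `Γ \ SL(2, ℝ)` induced by a Haar measure `m` on `SL(2, ℝ)` and a fundamental
domain `F` of `Γ`; for `m F = 1` it is the normalised Liouville measure. -/
def liouville (Γ : Subgroup SL2R) (m : Measure SL2R) (F : Set SL2R) : Measure (CosetSpace Γ) :=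
  (m.restrict F).map (toCoset Γ)

/-- `lam (φ_t E) → μ E` as `t → ∞` for all Borel sets `E` with `μ`-null boundary. -/
def IsAdmissible (Γ : Subgroup SL2R) (μ lam : Measure (CosetSpace Γ)) : Prop :=
  ∀ E : Set (CosetSpace Γ), MeasurableSet E → μ (frontier E) = 0 →
    Tendsto (fun t : ℝ => lam (geodesicFlow Γ t '' E)) atTop (𝓝 (μ E))

/-- The point of `ℝ ∪ {∞}`, the boundary of the upper half plane, to which the geodesic with
initial data `g` tends in forward time. -/
def endpoint (g : SL2R) : OnePoint ℝ :=
  Matrix.SpecialLinearGroup.toGL g • (OnePoint.infty : OnePoint ℝ)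

/-- The points `Γ g_1, …, Γ g_K` lie on the closed stable horocycles of length one around the
cusps of `Γ`, exactly one for each cusp (that is, for each `Γ`-orbit of parabolic fixed points). -/
structure IsCuspSystem (Γ : Subgroup SL2R) {K : ℕ} (g : Fin K → SL2R) : Prop where
  isCusp : ∀ κ, IsCusp (endpoint (g κ)) (Γ.map Matrix.SpecialLinearGroup.toGL)
  existsUnique : ∀ c : OnePoint ℝ, IsCusp c (Γ.map Matrix.SpecialLinearGroup.toGL) →
    ∃! κ, ∃ γ ∈ Γ, Matrix.SpecialLinearGroup.toGL γ • c = endpoint (g κ)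
  length_one : ∀ κ (s : ℝ),
    stableFlow Γ s (toCoset Γ (g κ)) = toCoset Γ (g κ) ↔ ∃ n : ℤ, s = n

section Sections

variable (Γ : Subgroup SL2R) {K : ℕ} (g : Fin K → SL2R) (σ : Fin K → ℝ) (R : ℝ)

/-- The stable horocycle `C_κ` through `x_κ = Γ g_κ`. -/
def cuspHorocycle (κ : Fin K) : Set (CosetSpace Γ) :=
  range fun s : ℝ => stableFlow Γ s (toCoset Γ (g κ))

/-- The section `H_κ(R)`, the union of the `φ_t(C_κ)` with `t ≥ R`. -/
def cuspSection (κ : Fin K) : Set (CosetSpace Γ) :=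
  ⋃ t ∈ Ici R, geodesicFlow Γ t '' cuspHorocycle Γ g κ

/-- The union `H(σ, R)` of the sections `H_κ(σ_κ + R)`. -/
def multiSection : Set (CosetSpace Γ) :=
  ⋃ κ, cuspSection Γ g (σ κ + R) κ

/-- The parameter domain of all `(s, t, κ)` with `0 ≤ s < 1` and `t ≥ σ_κ`. -/
def paramDomain : Set (ℝ × ℝ × Fin K) :=
  {w | w.1 ∈ Ico (0 : ℝ) 1 ∧ σ w.2.2 ≤ w.2.1}

/-- The parametrisation `(s, t, κ) ↦ φ_{t+R} (h⁻_s (x_κ))` of `H(σ, R)`. -/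
def param (w : ℝ × ℝ × Fin K) : CosetSpace Γ :=
  geodesicFlow Γ (w.2.1 + R) (stableFlow Γ w.1 (toCoset Γ (g w.2.2)))

/-- The first time `r > 0` at which the forward orbit of `x` under the unstable horocycle flow
is in `H(σ, R)`; it is `∞` if there is no such time. -/
def hittingTime (x : CosetSpace Γ) : ENNReal :=
  ⨅ r ∈ {r : ℝ | 0 < r ∧ unstableFlow Γ r x ∈ multiSection Γ g σ R}, ENNReal.ofReal r

/-- The first time `r > 0` at which the backward orbit of `x` under the unstable horocycle flow
is in `H(σ, R)`; it is `∞` if there is no such time. -/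
def backwardHittingTime (x : CosetSpace Γ) : ENNReal :=
  ⨅ r ∈ {r : ℝ | 0 < r ∧ unstableFlow Γ (-r) x ∈ multiSection Γ g σ R}, ENNReal.ofReal r

/-- `w` is the impact parameter of the first hit: the first hitting time of `x` is finite, and the
location of the first hit is the point of `H(σ, R)` with parameter `w`. -/
def IsFirstImpact (x : CosetSpace Γ) (w : ℝ × ℝ × Fin K) : Prop :=
  hittingTime Γ g σ R x ≠ ⊤ ∧ w ∈ paramDomain σ ∧
    param Γ g R w = unstableFlow Γ (hittingTime Γ g σ R x).toReal x

/-- The first return time `η₁` to `H(σ, 0)`. -/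
def returnTime (w : ℝ × ℝ × Fin K) : ENNReal :=
  hittingTime Γ g σ 0 (param Γ g 0 w)

/-- The first backward return time `η₋₁` to `H(σ, 0)`. -/
def backwardReturnTime (w : ℝ × ℝ × Fin K) : ENNReal :=
  backwardHittingTime Γ g σ 0 (param Γ g 0 w)

/-- Lebesgue measure `ds dt` on each of the `K` sheets of `ℝ × ℝ × {1, …, K}`. -/
def sheetLebesgue (K : ℕ) : Measure (ℝ × ℝ × Fin K) :=
  (volume : Measure ℝ).prod ((volume : Measure ℝ).prod Measure.count)

/-- The measure `e^{-t} ds dt` on each sheet of the parameter domain. -/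
def sectionMeasure : Measure (ℝ × ℝ × Fin K) :=
  ((sheetLebesgue K).restrict (paramDomain σ)).withDensity
    fun w => ENNReal.ofReal (Real.exp (-w.2.1))

/-- The integral of the first return time over the section. -/
def meanReturnTime : ENNReal :=
  ∫⁻ w, returnTime Γ g σ w ∂(sectionMeasure σ)

open Classical in
/-- The limit density. -/
def limitDensity (r : ℝ) (w : ℝ × ℝ × Fin K) : ℝ :=
  if ENNReal.ofReal r < backwardReturnTime Γ g σ w then 1 / (meanReturnTime Γ g σ).toReal else 0

end Sections

end CuspHitting

end

noncomputable section

namespace CuspHitting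

/-! ### The group `SL(2, ℝ)` -/

/-! Renormalisation. The geodesic flow carries H(σ,0) onto H(σ,R) and rescales unstable horocycle
time by `e^R`, so the set whose `lam`-measure is wanted is the image under `φ_R` of one fixed set E,
the `impactSet` (`setOf_firstImpact_eq_image`). Admissibility then gives the limit μ(E), once E is
known to be Borel with μ-null boundary. What remains is to compute μ(E) and to control its frontier.

Flow box. A point whose forward orbit hits the section is determined by its first hitting time r and
impact parameter w. It equals `h⁺_{-r}(ι(w))`, and the possible pairs are exactly those with 0 < r ≤
η₋₁(w). Thus `flowBox` is injective on `boxDomain`, and E corresponds to w ∈ D, r > X. On the open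
cell of products upper · diagonal · lower, Haar measure is a multiple of `e^{-t} dr ds dt`
(`exists_comap_cell_eq`), so μ becomes `k · dr ⊗ ν_σ` in these coordinates
(`exists_liouville_image_flowBox`). Almost every orbit hits the section (`ae_nonempty_hitSet`), so
the box has full measure and k ∫ η₋₁ dν_σ = 1. The same box with time reversed has the same k and
gives k ∫ η₁ dν_σ = 1. Hence k is the reciprocal of the mean return time. The sign `ε = ±1` handles
both directions of time at once.

Row vectors. Hits are encoded by the lower rows p of `g_κ⁻¹ Γ`: the orbit of `Γ h` meets the section
at time r exactly when some `p h = (x, y)` satisfies x = r y and 0 < y ≤ `e^{-σ_κ/2}`. These rows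
form a locally finite set (`finite_cuspRows_le`), so first hits are attained and return times are
lower semicontinuous on the section (`lowerSemicontinuous_firstHit_param`). With openness of the
flow box map, this makes the frontier of E null (`liouville_frontier_impactSet`). -/

theorem SL2R.ext_entries {A B : SL2R} (h00 : A 0 0 = B 0 0) (h01 : A 0 1 = B 0 1)
    (h10 : A 1 0 = B 1 0) (h11 : A 1 1 = B 1 1) : A = B := by
  apply Matrix.SpecialLinearGroup.ext
  intro i j
  fin_cases i <;> fin_cases j <;> assumption

theorem SL2R.det_entries (A : SL2R) : A 0 0 * A 1 1 - A 0 1 * A 1 0 = 1 := by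
  have := A.det_coe
  rwa [Matrix.det_fin_two] at this

theorem SL2R.mul_entry (A B : SL2R) (i j : Fin 2) :
    (A * B) i j = A i 0 * B 0 j + A i 1 * B 1 j := by
  rw [Matrix.SpecialLinearGroup.coe_mul, Matrix.mul_apply, Fin.sum_univ_two]

section Entries

variable (t : ℝ)

@[simp] theorem diagMatrix_00 : diagMatrix t 0 0 = Real.exp (t / 2) := rfl
@[simp] theorem diagMatrix_01 : diagMatrix t 0 1 = 0 := rfl
@[simp] theorem diagMatrix_10 : diagMatrix t 1 0 = 0 := rfl
@[simp] theorem diagMatrix_11 : diagMatrix t 1 1 = Real.exp (-t / 2) := rfl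
@[simp] theorem upperMatrix_00 : upperMatrix t 0 0 = 1 := rfl
@[simp] theorem upperMatrix_01 : upperMatrix t 0 1 = t := rfl
@[simp] theorem upperMatrix_10 : upperMatrix t 1 0 = 0 := rfl
@[simp] theorem upperMatrix_11 : upperMatrix t 1 1 = 1 := rfl
@[simp] theorem lowerMatrix_00 : lowerMatrix t 0 0 = 1 := rfl
@[simp] theorem lowerMatrix_01 : lowerMatrix t 0 1 = 0 := rfl
@[simp] theorem lowerMatrix_10 : lowerMatrix t 1 0 = -t := rfl
@[simp] theorem lowerMatrix_11 : lowerMatrix t 1 1 = 1 := rfl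

end Entries

theorem upperMatrix_add (s t : ℝ) : upperMatrix (s + t) = upperMatrix s * upperMatrix t := by
  apply SL2R.ext_entries <;> simp [SL2R.mul_entry, add_comm]

theorem lowerMatrix_add (s t : ℝ) : lowerMatrix (s + t) = lowerMatrix s * lowerMatrix t := by
  apply SL2R.ext_entries <;> simp [SL2R.mul_entry, add_comm]

theorem diagMatrix_add (s t : ℝ) : diagMatrix (s + t) = diagMatrix s * diagMatrix t := by
  apply SL2R.ext_entries <;> simp [SL2R.mul_entry, ← Real.exp_add] <;> ring

@[simp] theorem upperMatrix_zero : upperMatrix 0 = 1 := by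
  apply SL2R.ext_entries <;> simp

@[simp] theorem lowerMatrix_zero : lowerMatrix 0 = 1 := by
  apply SL2R.ext_entries <;> simp

@[simp] theorem diagMatrix_zero : diagMatrix 0 = 1 := by
  apply SL2R.ext_entries <;> simp

theorem upperMatrix_neg (s : ℝ) : upperMatrix (-s) = (upperMatrix s)⁻¹ := by
  rw [eq_inv_iff_mul_eq_one, ← upperMatrix_add]; simp

theorem lowerMatrix_neg (s : ℝ) : lowerMatrix (-s) = (lowerMatrix s)⁻¹ := by
  rw [eq_inv_iff_mul_eq_one, ← lowerMatrix_add]; simp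

theorem diagMatrix_neg (s : ℝ) : diagMatrix (-s) = (diagMatrix s)⁻¹ := by
  rw [eq_inv_iff_mul_eq_one, ← diagMatrix_add]; simp

theorem diagMatrix_mul_lowerMatrix (t r : ℝ) :
    diagMatrix t * lowerMatrix r = lowerMatrix (Real.exp (-t) * r) * diagMatrix t := by
  apply SL2R.ext_entries <;> simp [SL2R.mul_entry]
  rw [mul_right_comm, ← Real.exp_add]
  ring_nf

theorem diagMatrix_mul_upperMatrix (t s : ℝ) :
    diagMatrix t * upperMatrix s = upperMatrix (Real.exp t * s) * diagMatrix t := by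
  apply SL2R.ext_entries <;> simp [SL2R.mul_entry]
  rw [mul_right_comm, ← Real.exp_add]
  ring_nf

theorem continuous_SL2R_mk {α : Type*} [TopologicalSpace α] {f : α → SL2R}
    (h : ∀ i j, Continuous fun x => f x i j) : Continuous f :=
  (Matrix.SpecialLinearGroup.isClosedEmbedding_val
    (n := Fin 2) (R := ℝ)).isInducing.continuous_iff.2 (continuous_matrix h)

@[fun_prop]
theorem continuous_entry (i j : Fin 2) : Continuous fun A : SL2R => A i j := by
  fun_prop

@[fun_prop]
theorem continuous_upperMatrix : Continuous upperMatrix := by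
  refine continuous_SL2R_mk fun i j => ?_
  fin_cases i <;> fin_cases j <;> simp <;> fun_prop

@[fun_prop]
theorem continuous_lowerMatrix : Continuous lowerMatrix := by
  refine continuous_SL2R_mk fun i j => ?_
  fin_cases i <;> fin_cases j <;> simp <;> fun_prop

@[fun_prop]
theorem continuous_diagMatrix : Continuous diagMatrix := by
  refine continuous_SL2R_mk fun i j => ?_
  fin_cases i <;> fin_cases j <;> simp <;> fun_prop

instance : T2Space SL2R :=
  (Matrix.SpecialLinearGroup.isClosedEmbedding_val (n := Fin 2) (R := ℝ)).isEmbedding.t2Space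

instance : SecondCountableTopology SL2R :=
  haveI : SecondCountableTopology (Matrix (Fin 2) (Fin 2) ℝ) :=
    inferInstanceAs (SecondCountableTopology (Fin 2 → Fin 2 → ℝ))
  (Matrix.SpecialLinearGroup.isClosedEmbedding_val
    (n := Fin 2) (R := ℝ)).isEmbedding.secondCountableTopology

instance : LocallyCompactSpace SL2R :=
  haveI : LocallyCompactSpace (Matrix (Fin 2) (Fin 2) ℝ) :=
    inferInstanceAs (LocallyCompactSpace (Fin 2 → Fin 2 → ℝ))
  (Matrix.SpecialLinearGroup.isClosedEmbedding_val
    (n := Fin 2) (R := ℝ)).locallyCompactSpace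

instance : PolishSpace SL2R :=
  haveI : PolishSpace (Matrix (Fin 2) (Fin 2) ℝ) :=
    inferInstanceAs (PolishSpace (Fin 2 → Fin 2 → ℝ))
  (Matrix.SpecialLinearGroup.isClosedEmbedding_val (n := Fin 2) (R := ℝ)).polishSpace

theorem isCompact_entries_le (B : ℝ) : IsCompact {A : SL2R | ∀ i j, |A i j| ≤ B} := by
  have h : IsCompact (univ.pi fun _ : Fin 2 => univ.pi fun _ : Fin 2 => Icc (-B) B) :=
    isCompact_univ_pi fun _ => isCompact_univ_pi fun _ => isCompact_Icc
  have h2 := (Matrix.SpecialLinearGroup.isClosedEmbedding_val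
    (n := Fin 2) (R := ℝ)).isCompact_preimage (K := univ.pi fun _ => univ.pi fun _ => Icc (-B) B) h
  have he : {A : SL2R | ∀ i j, |A i j| ≤ B} = (fun A : SL2R => (A : Matrix (Fin 2) (Fin 2) ℝ)) ⁻¹'
      (univ.pi fun _ => univ.pi fun _ => Icc (-B) B) :=
    Set.ext fun A => ⟨fun hA i _ j _ => abs_le.1 (hA i j),
      fun hA i j => abs_le.2 (hA i trivial j trivial)⟩
  rw [he]
  exact h2

/-! ### Coordinates on the open cell -/

/-- The coordinates `(r, s, t)` on the open cell of matrices with positive lower right entry. -/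
def cell (q : ℝ × ℝ × ℝ) : SL2R := upperMatrix q.2.1 * diagMatrix q.2.2 * lowerMatrix (-q.1)

theorem cell_01 (q : ℝ × ℝ × ℝ) : cell q 0 1 = q.2.1 * Real.exp (-q.2.2 / 2) := by
  simp [cell, SL2R.mul_entry]

theorem cell_10 (q : ℝ × ℝ × ℝ) : cell q 1 0 = q.1 * Real.exp (-q.2.2 / 2) := by
  simp [cell, SL2R.mul_entry, mul_comm]

theorem cell_11 (q : ℝ × ℝ × ℝ) : cell q 1 1 = Real.exp (-q.2.2 / 2) := by
  simp [cell, SL2R.mul_entry]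

theorem continuous_cell : Continuous cell := by
  unfold cell
  fun_prop

/-- The inverse of `cell`. -/
def cellCoord (A : SL2R) : ℝ × ℝ × ℝ :=
  (A 1 0 / A 1 1, A 0 1 / A 1 1, -2 * Real.log (A 1 1))

theorem cellCoord_cell (q : ℝ × ℝ × ℝ) : cellCoord (cell q) = q := by
  have := (Real.exp_pos (-q.2.2 / 2)).ne'
  ext
  · simp [cellCoord, cell_10, cell_11]
  · simp [cellCoord, cell_01, cell_11]
  · simp [cellCoord, cell_11]; ring

theorem cell_injective : Function.Injective cell :=
  Function.LeftInverse.injective cellCoord_cell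

theorem cell_cellCoord {A : SL2R} (hA : 0 < A 1 1) : cell (cellCoord A) = A := by
  have h : Real.exp (-(-2 * Real.log (A 1 1)) / 2) = A 1 1 := by
    rw [show -(-2 * Real.log (A 1 1)) / 2 = Real.log (A 1 1) by ring, Real.exp_log hA]
  have h01 : cell (cellCoord A) 0 1 = A 0 1 := by
    rw [cell_01]; simp only [cellCoord, h]; field_simp
  have h10 : cell (cellCoord A) 1 0 = A 1 0 := by
    rw [cell_10]; simp only [cellCoord, h]; field_simp
  have h11 : cell (cellCoord A) 1 1 = A 1 1 := by
    rw [cell_11]; simp only [cellCoord, h]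
  refine SL2R.ext_entries ?_ h01 h10 h11
  have h1 := SL2R.det_entries A
  have h2 := SL2R.det_entries (cell (cellCoord A))
  rw [h01, h10, h11] at h2
  apply mul_right_cancel₀ hA.ne'
  linarith

theorem isOpenMap_cell : IsOpenMap cell := by
  intro U hU
  have : cell '' U = {A : SL2R | 0 < A 1 1} ∩ cellCoord ⁻¹' U := by
    ext A
    constructor
    · rintro ⟨q, hq, rfl⟩
      refine ⟨?_, by rwa [mem_preimage, cellCoord_cell]⟩
      simp only [mem_ofPred_eq, cell_11]
      exact Real.exp_pos _
    · rintro ⟨h1, h2⟩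
      exact ⟨_, h2, cell_cellCoord h1⟩
  rw [this]
  have ho : IsOpen {A : SL2R | 0 < A 1 1} := isOpen_lt continuous_const (by fun_prop)
  refine ContinuousOn.isOpen_inter_preimage ?_ ho hU
  have hne : ∀ A ∈ {A : SL2R | 0 < A 1 1}, A 1 1 ≠ 0 := fun A hA => ne_of_gt hA
  unfold cellCoord
  have c (i j) : ContinuousOn (fun A : SL2R => A i j) {A : SL2R | 0 < A 1 1} :=
    (continuous_entry i j).continuousOn
  exact ((c 1 0).div (c 1 1) hne).prodMk
    (((c 0 1).div (c 1 1) hne).prodMk (continuousOn_const.mul ((c 1 1).log hne)))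

theorem measurableEmbedding_cell : MeasurableEmbedding cell :=
  continuous_cell.measurableEmbedding cell_injective

/-! ### The coset space -/

section Coset

variable (Γ : Subgroup SL2R)

theorem toCoset_eq_iff {a b : SL2R} : toCoset Γ a = toCoset Γ b ↔ ∃ γ ∈ Γ, γ * a = b := by
  have h : toCoset Γ a = toCoset Γ b ↔ QuotientGroup.rightRel Γ a b :=
    Quotient.eq (r := QuotientGroup.rightRel Γ)
  rw [h, QuotientGroup.rightRel_apply]
  constructor
  · intro h
    exact ⟨_, h, by simp⟩
  · rintro ⟨γ, hγ, rfl⟩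
    simpa using hγ

theorem toCoset_mul_left {γ : SL2R} (hγ : γ ∈ Γ) (a : SL2R) :
    toCoset Γ (γ * a) = toCoset Γ a :=
  ((toCoset_eq_iff Γ).2 ⟨γ, hγ, rfl⟩).symm

theorem toCoset_surjective : Function.Surjective (toCoset Γ) := Quotient.mk_surjective

@[simp] theorem rightTranslate_toCoset (a h : SL2R) :
    rightTranslate Γ a (toCoset Γ h) = toCoset Γ (h * a) := rfl

@[simp] theorem geodesicFlow_toCoset (t : ℝ) (h : SL2R) :
    geodesicFlow Γ t (toCoset Γ h) = toCoset Γ (h * diagMatrix t) := rfl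

@[simp] theorem unstableFlow_toCoset (t : ℝ) (h : SL2R) :
    unstableFlow Γ t (toCoset Γ h) = toCoset Γ (h * lowerMatrix t) := rfl

@[simp] theorem stableFlow_toCoset (t : ℝ) (h : SL2R) :
    stableFlow Γ t (toCoset Γ h) = toCoset Γ (h * upperMatrix t) := rfl

theorem rightTranslate_rightTranslate (a b : SL2R) (x : CosetSpace Γ) :
    rightTranslate Γ a (rightTranslate Γ b x) = rightTranslate Γ (b * a) x := by
  obtain ⟨h, rfl⟩ := toCoset_surjective Γ x
  simp [mul_assoc]

theorem rightTranslate_one (x : CosetSpace Γ) : rightTranslate Γ 1 x = x := by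
  obtain ⟨h, rfl⟩ := toCoset_surjective Γ x
  simp

theorem unstableFlow_unstableFlow (r s : ℝ) (x : CosetSpace Γ) :
    unstableFlow Γ r (unstableFlow Γ s x) = unstableFlow Γ (s + r) x := by
  simp only [unstableFlow, rightTranslate_rightTranslate, lowerMatrix_add]

theorem unstableFlow_zero (x : CosetSpace Γ) : unstableFlow Γ 0 x = x := by
  simp only [unstableFlow, lowerMatrix_zero, rightTranslate_one]

theorem geodesicFlow_neg_geodesicFlow (t : ℝ) (x : CosetSpace Γ) :
    geodesicFlow Γ (-t) (geodesicFlow Γ t x) = x := by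
  simp only [geodesicFlow, rightTranslate_rightTranslate, ← diagMatrix_add]
  simp [rightTranslate_one]

theorem geodesicFlow_geodesicFlow_neg (t : ℝ) (x : CosetSpace Γ) :
    geodesicFlow Γ t (geodesicFlow Γ (-t) x) = x := by
  simpa using geodesicFlow_neg_geodesicFlow Γ (-t) x

theorem unstableFlow_geodesicFlow (t r : ℝ) (x : CosetSpace Γ) :
    unstableFlow Γ r (geodesicFlow Γ t x) =
      geodesicFlow Γ t (unstableFlow Γ (Real.exp (-t) * r) x) := by
  simp only [unstableFlow, geodesicFlow, rightTranslate_rightTranslate,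
    diagMatrix_mul_lowerMatrix]

theorem continuous_toCoset : Continuous (toCoset Γ) := continuous_quotient_mk'

theorem preimage_toCoset_image (B : Set SL2R) :
    toCoset Γ ⁻¹' (toCoset Γ '' B) = ⋃ γ : Γ, (fun h => (γ : SL2R) * h) ⁻¹' B := by
  ext h
  simp only [mem_preimage, mem_image, mem_iUnion, Subtype.exists, toCoset_eq_iff]
  constructor
  · rintro ⟨b, hb, γ, hγ, rfl⟩
    exact ⟨γ⁻¹, Γ.inv_mem hγ, by simpa using hb⟩
  · rintro ⟨γ, hγ, hb⟩
    exact ⟨_, hb, γ⁻¹, Γ.inv_mem hγ, by simp⟩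

theorem isOpenMap_toCoset : IsOpenMap (toCoset Γ) := by
  intro U hU
  have : IsOpen (toCoset Γ ⁻¹' (toCoset Γ '' U)) := by
    rw [preimage_toCoset_image]
    exact isOpen_iUnion fun γ => hU.preimage (continuous_const_mul _)
  exact this

theorem isOpenQuotientMap_toCoset : IsOpenQuotientMap (toCoset Γ) :=
  ⟨toCoset_surjective Γ, continuous_toCoset Γ, isOpenMap_toCoset Γ⟩

/-- The diagonal pulls back to the pairs (a, b) with `b a⁻¹ ∈ Γ`, and a discrete subgroup is closed.
The Hausdorff property is needed for injective continuous images of Borel sets to be Borel. -/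
theorem t2Space_cosetSpace [DiscreteTopology Γ] : T2Space (CosetSpace Γ) := by
  rw [t2_iff_isClosed_diagonal]
  have h := (isOpenQuotientMap_toCoset Γ).prodMap (isOpenQuotientMap_toCoset Γ)
  rw [← h.isQuotientMap.isClosed_preimage]
  have hc : IsClosed (Γ : Set SL2R) := Subgroup.isClosed_of_discrete
  convert hc.preimage (f := fun p : SL2R × SL2R => p.2 * p.1⁻¹) (by fun_prop) using 1
  ext ⟨a, b⟩
  simp only [mem_preimage, Prod.map, mem_diagonal_iff, toCoset_eq_iff, SetLike.mem_coe]
  constructor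
  · rintro ⟨γ, hγ, rfl⟩
    simpa using hγ
  · intro h
    exact ⟨_, h, by simp⟩

theorem finite_subgroup_entries_le [DiscreteTopology Γ] (B : ℝ) :
    {A : SL2R | A ∈ Γ ∧ ∀ i j, |A i j| ≤ B}.Finite := by
  have hc : IsClosed (Γ : Set SL2R) := Subgroup.isClosed_of_discrete
  have hd : IsDiscrete (Γ : Set SL2R) := isDiscrete_iff_discreteTopology.mpr inferInstance
  exact ((isCompact_entries_le B).inter_left hc).finite (hd.mono inter_subset_left)

end Coset

/-! ### Haar measure in cell coordinates -/

section Unimodular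

open Measure

/-- A suitable diagonal matrix conjugates the unipotent element to its square, so its character
value c satisfies c = c² with c nonzero. -/
theorem modularCharacter_lowerMatrix (r : ℝ) : modularCharacter (lowerMatrix r) = 1 := by
  have h1 : diagMatrix (-Real.log 2) * lowerMatrix r =
      lowerMatrix r * lowerMatrix r * diagMatrix (-Real.log 2) := by
    rw [diagMatrix_mul_lowerMatrix, neg_neg, Real.exp_log (by norm_num), ← lowerMatrix_add, two_mul]
  have h2 := congrArg modularCharacter h1
  simp only [map_mul] at h2
  have hd : (modularCharacter (diagMatrix (-Real.log 2))) ≠ 0 := (modularCharacterFun_pos _).ne'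
  have hl : (modularCharacter (lowerMatrix r)) ≠ 0 := (modularCharacterFun_pos _).ne'
  rw [mul_comm] at h2
  have h3 := mul_right_cancel₀ hd h2
  exact (mul_eq_left₀ hl).1 h3.symm

theorem modularCharacter_upperMatrix (r : ℝ) : modularCharacter (upperMatrix r) = 1 := by
  have h1 : diagMatrix (Real.log 2) * upperMatrix r =
      upperMatrix r * upperMatrix r * diagMatrix (Real.log 2) := by
    rw [diagMatrix_mul_upperMatrix, Real.exp_log (by norm_num), ← upperMatrix_add, two_mul]
  have h2 := congrArg modularCharacter h1
  simp only [map_mul] at h2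
  have hd : (modularCharacter (diagMatrix (Real.log 2))) ≠ 0 := (modularCharacterFun_pos _).ne'
  have hl : (modularCharacter (upperMatrix r)) ≠ 0 := (modularCharacterFun_pos _).ne'
  rw [mul_comm] at h2
  have h3 := mul_right_cancel₀ hd h2
  exact (mul_eq_left₀ hl).1 h3.symm

/-- The Weyl element conjugates a diagonal matrix to its inverse, so the character value squares to
one. -/
theorem modularCharacter_diagMatrix (t : ℝ) : modularCharacter (diagMatrix t) = 1 := by
  let w : SL2R := ⟨!![0, 1; -1, 0], by simp [Matrix.det_fin_two_of]⟩
  have hw : w * diagMatrix t = diagMatrix (-t) * w := by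
    have e00 : w 0 0 = 0 := rfl
    have e01 : w 0 1 = 1 := rfl
    have e10 : w 1 0 = -1 := rfl
    have e11 : w 1 1 = 0 := rfl
    apply SL2R.ext_entries <;> simp [SL2R.mul_entry, e00, e01, e10, e11]
  have h2 := congrArg modularCharacter hw
  simp only [map_mul] at h2
  have hd : modularCharacter w ≠ 0 := (modularCharacterFun_pos _).ne'
  rw [mul_comm] at h2
  have h3 := mul_right_cancel₀ hd h2
  have h4 : modularCharacter (diagMatrix t) * modularCharacter (diagMatrix t) = 1 := by
    nth_rewrite 2 [h3]
    rw [← map_mul, ← diagMatrix_add]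
    simp
  rw [← sq] at h4
  exact (pow_eq_one_iff_of_nonneg zero_le two_ne_zero).1 h4

theorem measurePreserving_mul_right_of_modularCharacter_eq_one (m : Measure SL2R)
    [m.IsHaarMeasure] {a : SL2R} (ha : modularCharacter a = 1) :
    MeasurePreserving (· * a) m m := by
  refine ⟨(continuous_mul_const a).measurable, ?_⟩
  rw [map_right_mul_eq_modularCharacterFun_smul]
  change modularCharacter a • m = m
  rw [ha, one_smul]

end Unimodular

/-! ### Measures determined by translation and scaling -/

/-- A measure on `ℝ × Y` that is invariant under translations of the first coordinate is a product
with Lebesgue measure. -/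
theorem measure_prod_eq_of_translation_invariant {Y : Type*} [MeasurableSpace Y]
    (ρ : Measure (ℝ × Y)) [SFinite ρ]
    (hρ : ∀ u : ℝ, MeasurePreserving (fun p : ℝ × Y => (p.1 + u, p.2)) ρ ρ)
    {A : Set ℝ} (hA : MeasurableSet A) {T : Set Y} (hT : MeasurableSet T) :
    ρ (A ×ˢ T) = volume A * ρ (Ico 0 1 ×ˢ T) := by
  let f : ℝ → ENNReal := (Ico (0 : ℝ) 1).indicator 1
  let a : ℝ → ENNReal := A.indicator 1
  let b : Y → ENNReal := T.indicator 1
  have hf : Measurable f := measurable_one.indicator measurableSet_Ico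
  have ha : Measurable a := measurable_one.indicator hA
  have hb : Measurable b := measurable_one.indicator hT
  have h1 : ρ (A ×ˢ T) = ∫⁻ p, a p.1 * b p.2 ∂ρ := by
    rw [← lintegral_indicator_one (hA.prod hT)]
    congr 1 with p
    simp only [a, b, indicator, mem_prod]
    by_cases h1 : p.1 ∈ A <;> by_cases h2 : p.2 ∈ T <;> simp [h1, h2]
  have h2 : ρ (Ico 0 1 ×ˢ T) = ∫⁻ p, f p.1 * b p.2 ∂ρ := by
    rw [← lintegral_indicator_one (measurableSet_Ico.prod hT)]
    congr 1 with p
    simp only [f, b, indicator, mem_prod]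
    by_cases h1 : p.1 ∈ Ico (0 : ℝ) 1 <;> by_cases h2 : p.2 ∈ T <;> simp [h1, h2]
  have hf1 : ∫⁻ u, f u = 1 := by
    simp only [f]
    rw [lintegral_indicator_one measurableSet_Ico]
    simp
  have ha1 : ∫⁻ u, a u = volume A := lintegral_indicator_one hA
  calc ρ (A ×ˢ T) = ∫⁻ p, a p.1 * b p.2 ∂ρ := h1
    -- Insert 1 = ∫ f(p.1 + u) du, exchange the integrals and translate by u. This moves the window
    -- f onto p and frees the factor a to integrate to the volume of `A`.
    _ = ∫⁻ p, (∫⁻ u, a p.1 * b p.2 * f (p.1 + u)) ∂ρ := by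
        congr 1 with p
        rw [lintegral_const_mul _ (by fun_prop),
          lintegral_add_left_eq_self f, hf1, mul_one]
    _ = ∫⁻ u, ∫⁻ p, a p.1 * b p.2 * f (p.1 + u) ∂ρ := by
        rw [lintegral_lintegral_swap]
        refine Measurable.aemeasurable ?_
        unfold Function.uncurry
        dsimp only
        fun_prop
    _ = ∫⁻ u, ∫⁻ p, a (p.1 - u) * b p.2 * f p.1 ∂ρ := by
        congr 1 with u
        rw [← (hρ u).lintegral_comp (f := fun p => a (p.1 - u) * b p.2 * f p.1) (by fun_prop)]
        simp
    _ = ∫⁻ p, (∫⁻ u, a (p.1 - u) * b p.2 * f p.1) ∂ρ := by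
        rw [lintegral_lintegral_swap]
        refine Measurable.aemeasurable ?_
        unfold Function.uncurry
        dsimp only
        fun_prop
    _ = ∫⁻ p, volume A * (f p.1 * b p.2) ∂ρ := by
        congr 1 with p
        simp_rw [mul_assoc]
        rw [lintegral_mul_const _ (by fun_prop),
          lintegral_sub_left_eq_self a, ha1, mul_comm (b _)]
    _ = volume A * ρ (Ico 0 1 ×ˢ T) := by
        rw [lintegral_const_mul _ (by fun_prop), h2]

/-- The measure `e^{-t} dt` on the real line. -/
def expMeasure : Measure ℝ := volume.withDensity fun t => ENNReal.ofReal (Real.exp (-t))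

instance : SigmaFinite expMeasure := by
  unfold expMeasure
  exact SigmaFinite.withDensity_ofReal _

/-- A locally finite measure on the line that scales by `e^{u}` when pushed forward under
translation by `u` is a multiple of `e^{-t} dt`. -/
theorem exists_eq_smul_expMeasure (ρ : Measure ℝ) [IsLocallyFiniteMeasure ρ]
    (hρ : ∀ u : ℝ, ρ.map (fun t => u + t) = ENNReal.ofReal (Real.exp u) • ρ) :
    ∃ k : NNReal, ρ = k • expMeasure := by
  let e : ℝ → ENNReal := fun t => ENNReal.ofReal (Real.exp t)
  have he : Measurable e := by fun_prop
  have hadd (s t : ℝ) : e (s + t) = e s * e t := by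
    simp only [e, Real.exp_add]
    exact ENNReal.ofReal_mul (Real.exp_pos _).le
  have hzero : e 0 = 1 := by simp [e]
  -- The density `e^t` cancels the scaling factor, so ρ' is translation invariant, hence a multiple
  -- of Lebesgue measure.
  let ρ' := ρ.withDensity e
  have : IsLocallyFiniteMeasure ρ' := IsLocallyFiniteMeasure.withDensity_ofReal (by fun_prop)
  have : ρ'.IsAddLeftInvariant := by
    refine ⟨fun u => ?_⟩
    ext S hS
    rw [Measure.map_apply (by fun_prop) hS, withDensity_apply _ (measurable_const_add u hS),
      withDensity_apply _ hS]
    have h1 : ∫⁻ t in (fun t => u + t) ⁻¹' S, e t ∂ρ =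
        ∫⁻ t in S, e (-u) * e t ∂(ρ.map fun t => u + t) := by
      rw [setLIntegral_map hS (by fun_prop) (by fun_prop)]
      congr 1 with t
      rw [← hadd]
      ring_nf
    have h2 : e u * e (-u) = 1 := by rw [← hadd, add_neg_cancel, hzero]
    rw [h1, hρ, Measure.restrict_smul, lintegral_smul_measure, lintegral_const_mul _ he,
      smul_eq_mul, ← mul_assoc]
    change e u * e (-u) * _ = _
    rw [h2, one_mul]
  refine ⟨ρ'.addHaarScalarFactor volume, ?_⟩
  have h1 : ρ' = ρ'.addHaarScalarFactor volume • volume := Measure.isAddLeftInvariant_eq_smul _ _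
  have h2 : ρ = ρ'.withDensity fun t => e (-t) := by
    rw [← withDensity_mul _ he (by fun_prop)]
    have : (e * fun t => e (-t)) = 1 := by
      ext t
      simp only [Pi.mul_apply, Pi.one_apply]
      rw [← hadd, add_neg_cancel, hzero]
    rw [this, withDensity_one]
  rw [h2]
  nth_rewrite 1 [h1]
  rw [expMeasure]
  ext S hS
  rw [withDensity_apply _ hS, Measure.restrict_smul, Measure.smul_apply, withDensity_apply _ hS]
  exact lintegral_smul_measure _ _

/-- Surjectivity of `F` makes `f` map the cell onto itself, so a symmetry of m restricts to the cell
and can be read in coordinates. -/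
theorem measurePreserving_comap_cell (m : Measure SL2R) {f : SL2R → SL2R}
    (hf : MeasurePreserving f m m) (hfi : Function.Injective f) {F : ℝ × ℝ × ℝ → ℝ × ℝ × ℝ}
    (hF : Continuous F) (hFs : Function.Surjective F) (h : ∀ q, cell (F q) = f (cell q))
    (hfm : ∀ A, MeasurableSet A → MeasurableSet (f '' A)) :
    MeasurePreserving F (m.comap cell) (m.comap cell) := by
  refine ⟨hF.measurable, ?_⟩
  ext A hA
  rw [Measure.map_apply hF.measurable hA, measurableEmbedding_cell.comap_apply,
    measurableEmbedding_cell.comap_apply]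
  have h1 : f '' (cell '' (F ⁻¹' A)) = cell '' A := by
    rw [image_image]
    simp_rw [← h]
    rw [← image_image cell F, image_preimage_eq _ hFs]
  have h2 : MeasurableSet (cell '' (F ⁻¹' A)) :=
    measurableEmbedding_cell.measurableSet_image.2 (hF.measurable hA)
  rw [← h1, ← hf.measure_preimage (hfm _ h2).nullMeasurableSet, preimage_image_eq _ hfi]

/-- This and the next two identities supply the symmetries that determine Haar measure on the cell:
translations in r and in s, and a shift of t coupled with a dilation of s. The dilation is the
source of the weight `e^{-t}`. -/
theorem cell_shift_fst (q : ℝ × ℝ × ℝ) (u : ℝ) :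
    cell (q.1 + u, q.2) = cell q * lowerMatrix (-u) := by
  simp only [cell, neg_add, lowerMatrix_add, mul_assoc]

theorem cell_shift_snd (q : ℝ × ℝ × ℝ) (u : ℝ) :
    cell (q.1, q.2.1 + u, q.2.2) = upperMatrix u * cell q := by
  simp only [cell, add_comm _ u, upperMatrix_add, mul_assoc]

theorem cell_scale (q : ℝ × ℝ × ℝ) (u : ℝ) :
    cell (q.1, Real.exp u * q.2.1, u + q.2.2) = diagMatrix u * cell q := by
  simp only [cell, diagMatrix_add, ← mul_assoc, diagMatrix_mul_upperMatrix]

/-- In the coordinates of the open cell, a Haar measure is a multiple of `e^{-t} dr ds dt`. -/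
theorem exists_comap_cell_eq (m : Measure SL2R) [m.IsHaarMeasure] :
    ∃ k : NNReal, m.comap cell = k • (volume : Measure ℝ).prod
      ((volume : Measure ℝ).prod expMeasure) := by
  let ρ := m.comap cell
  have hmul (a : SL2R) : MeasurableEmbedding (a * ·) :=
    (Homeomorph.mulLeft a).measurableEmbedding
  have hmulr (a : SL2R) : MeasurableEmbedding (· * a) :=
    (Homeomorph.mulRight a).measurableEmbedding
  have hr (u : ℝ) : MeasurePreserving (fun q : ℝ × ℝ × ℝ => (q.1 + u, q.2)) ρ ρ := by
    refine measurePreserving_comap_cell m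
      (measurePreserving_mul_right_of_modularCharacter_eq_one m
        (modularCharacter_lowerMatrix (-u)))
      (mul_left_injective _) (by fun_prop) (fun q => ⟨(q.1 - u, q.2), by simp⟩)
      (fun q => cell_shift_fst q u) (fun A hA => (hmulr _).measurableSet_image.2 hA)
  have hs (u : ℝ) : MeasurePreserving (fun q : ℝ × ℝ × ℝ => (q.1, q.2.1 + u, q.2.2)) ρ ρ := by
    refine measurePreserving_comap_cell m (measurePreserving_mul_left m (upperMatrix u))
      (mul_right_injective _) (by fun_prop) (fun q => ⟨(q.1, q.2.1 - u, q.2.2), by simp⟩)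
      (fun q => cell_shift_snd q u) (fun A hA => (hmul _).measurableSet_image.2 hA)
  have ht (u : ℝ) :
      MeasurePreserving (fun q : ℝ × ℝ × ℝ => (q.1, Real.exp u * q.2.1, u + q.2.2)) ρ ρ := by
    refine measurePreserving_comap_cell m (measurePreserving_mul_left m (diagMatrix u))
      (mul_right_injective _) (by fun_prop)
      (fun q => ⟨(q.1, (Real.exp u)⁻¹ * q.2.1, q.2.2 - u), by simp⟩)
      (fun q => cell_scale q u) (fun A hA => (hmul _).measurableSet_image.2 hA)
  have hfin : IsFiniteMeasureOnCompacts ρ := by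
    refine ⟨fun C hC => ?_⟩
    rw [measurableEmbedding_cell.comap_apply]
    exact (hC.image continuous_cell).measure_lt_top
  -- Invariance in r splits off a Lebesgue factor. The other factor is the mass over one unit
  -- interval in r. The same is then done for s with ρ₂.
  let ρ₁ : Measure (ℝ × ℝ) := (ρ.restrict (Ico 0 1 ×ˢ univ)).map Prod.snd
  have hρ₁ {T : Set (ℝ × ℝ)} (hT : MeasurableSet T) : ρ₁ T = ρ (Ico 0 1 ×ˢ T) := by
    rw [Measure.map_apply measurable_snd hT, Measure.restrict_apply (measurable_snd hT)]
    congr 1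
    ext q
    simp [and_comm]
  have hfin₁ : IsFiniteMeasureOnCompacts ρ₁ := by
    refine ⟨fun C hC => ?_⟩
    rw [hρ₁ hC.measurableSet]
    exact (measure_mono (prod_mono_left Ico_subset_Icc_self)).trans_lt
      (isCompact_Icc.prod hC).measure_lt_top
  let ρ₂ : Measure ℝ := (ρ₁.restrict (Ico 0 1 ×ˢ univ)).map Prod.snd
  have hρ₂ {T : Set ℝ} (hT : MeasurableSet T) : ρ₂ T = ρ₁ (Ico 0 1 ×ˢ T) := by
    rw [Measure.map_apply measurable_snd hT, Measure.restrict_apply (measurable_snd hT)]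
    congr 1
    ext q
    simp [and_comm]
  have hfin₂ : IsFiniteMeasureOnCompacts ρ₂ := by
    refine ⟨fun C hC => ?_⟩
    rw [hρ₂ hC.measurableSet]
    exact (measure_mono (prod_mono_left Ico_subset_Icc_self)).trans_lt
      (isCompact_Icc.prod hC).measure_lt_top
  have hs₁ (u : ℝ) : MeasurePreserving (fun q : ℝ × ℝ => (q.1 + u, q.2)) ρ₁ ρ₁ := by
    refine ⟨by fun_prop, ?_⟩
    ext T hT
    have hT' : MeasurableSet ((fun q : ℝ × ℝ => (q.1 + u, q.2)) ⁻¹' T) := by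
      exact (by fun_prop : Measurable fun q : ℝ × ℝ => (q.1 + u, q.2)) hT
    rw [Measure.map_apply (by fun_prop) hT, hρ₁ hT, hρ₁ hT',
      ← (hs u).measure_preimage (measurableSet_Ico.prod hT).nullMeasurableSet]
    rfl
  have hprod₁ {A : Set ℝ} (hA : MeasurableSet A) {T : Set ℝ} (hT : MeasurableSet T) :
      ρ₁ (A ×ˢ T) = volume A * ρ₂ T := by
    rw [measure_prod_eq_of_translation_invariant ρ₁ hs₁ hA hT, hρ₂ hT]
  have hρ₂' (u : ℝ) : ρ₂.map (fun t => u + t) = ENNReal.ofReal (Real.exp u) • ρ₂ := by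
    ext T hT
    have hT' : MeasurableSet ((fun t => u + t) ⁻¹' T) := measurable_const_add u hT
    rw [Measure.map_apply (by fun_prop) hT, Measure.smul_apply, smul_eq_mul, hρ₂ hT',
      hρ₁ (measurableSet_Ico.prod hT')]
    -- Undoing the shift of t stretches the unit interval in s to length `e^u`, which is the scaling
    -- factor claimed for ρ₂.
    have h1 : (Ico (0 : ℝ) 1 ×ˢ (Ico (0 : ℝ) 1 ×ˢ ((fun t => u + t) ⁻¹' T))) =
        (fun q : ℝ × ℝ × ℝ => (q.1, Real.exp u * q.2.1, u + q.2.2)) ⁻¹'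
          (Ico (0 : ℝ) 1 ×ˢ (Ico (0 : ℝ) (Real.exp u) ×ˢ T)) := by
      ext q
      have := Real.exp_pos u
      simp [this]
    rw [h1, (ht u).measure_preimage
      (measurableSet_Ico.prod (measurableSet_Ico.prod hT)).nullMeasurableSet,
      ← hρ₁ (measurableSet_Ico.prod hT), hprod₁ measurableSet_Ico hT]
    simp
  obtain ⟨k, hk⟩ := exists_eq_smul_expMeasure ρ₂ hρ₂'
  refine ⟨k, ?_⟩
  have e1 : (volume : Measure ℝ).prod ρ₂ = ρ₁ := Measure.prod_eq fun A T hA hT => hprod₁ hA hT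
  have e2 : (volume : Measure ℝ).prod ρ₁ = ρ := Measure.prod_eq fun A T hA hT => by
    rw [measure_prod_eq_of_translation_invariant ρ hr hA hT, hρ₁ hT]
  change ρ = _
  rw [← e2, ← e1, hk]
  have (c : NNReal) {Y : Type} [MeasurableSpace Y] (ν : Measure Y) [SFinite ν] :
      (volume : Measure ℝ).prod (c • ν) = c • (volume : Measure ℝ).prod ν := by
    ext A hA
    simp only [Measure.prod_apply hA, Measure.smul_apply]
    exact lintegral_const_mul' _ _ ENNReal.coe_ne_top
  rw [this, this]

/-! ### Orbits of row vectors attached to the cusps -/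

/-- The row vector `p` times the matrix `h`. -/
def rowMul (p : ℝ × ℝ) (h : SL2R) : ℝ × ℝ :=
  (p.1 * h 0 0 + p.2 * h 1 0, p.1 * h 0 1 + p.2 * h 1 1)

/-- The lower row of a matrix. -/
def lowerRow (A : SL2R) : ℝ × ℝ := (A 1 0, A 1 1)

theorem rowMul_lowerRow (A h : SL2R) : rowMul (lowerRow A) h = lowerRow (A * h) := by
  simp [rowMul, lowerRow, SL2R.mul_entry]

theorem rowMul_mul (p : ℝ × ℝ) (h k : SL2R) : rowMul p (h * k) = rowMul (rowMul p h) k := by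
  ext <;> simp only [rowMul, SL2R.mul_entry] <;> ring

@[fun_prop]
theorem continuous_rowMul (p : ℝ × ℝ) : Continuous (rowMul p) := by
  unfold rowMul
  fun_prop

theorem fst_eq_of_rowMul (p : ℝ × ℝ) (h : SL2R) :
    p.1 = (rowMul p h).1 * h 1 1 - (rowMul p h).2 * h 1 0 := by
  have := SL2R.det_entries h
  simp only [rowMul]
  linear_combination -p.1 * this

theorem snd_eq_of_rowMul (p : ℝ × ℝ) (h : SL2R) :
    p.2 = (rowMul p h).2 * h 0 0 - (rowMul p h).1 * h 0 1 := by
  have := SL2R.det_entries h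
  simp only [rowMul]
  linear_combination -p.2 * this

theorem lowerRow_ne_zero (A : SL2R) : lowerRow A ≠ 0 := by
  intro h
  have h0 : A 1 0 = 0 := congrArg Prod.fst h
  have h1 : A 1 1 = 0 := congrArg Prod.snd h
  have := SL2R.det_entries A
  simp [h0, h1] at this

/-- The lower rows of the matrices in `a⁻¹ Γ`. -/
def cuspRows (Γ : Subgroup SL2R) (a : SL2R) : Set (ℝ × ℝ) :=
  {p | ∃ γ ∈ Γ, lowerRow (a⁻¹ * γ) = p}

theorem rowMul_mem_cuspRows {Γ : Subgroup SL2R} {a : SL2R} {p : ℝ × ℝ} (hp : p ∈ cuspRows Γ a)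
    {γ : SL2R} (hγ : γ ∈ Γ) : rowMul p γ ∈ cuspRows Γ a := by
  obtain ⟨γ', h', rfl⟩ := hp
  exact ⟨γ' * γ, Γ.mul_mem h' hγ, by rw [rowMul_lowerRow, mul_assoc]⟩

theorem neg_mem_cuspRows {Γ : Subgroup SL2R} (hneg : (-1 : SL2R) ∈ Γ) {a : SL2R} {p : ℝ × ℝ}
    (hp : p ∈ cuspRows Γ a) : -p ∈ cuspRows Γ a := by
  have h := rowMul_mem_cuspRows hp hneg
  convert h using 1
  ext <;> simp [rowMul]

theorem countable_cuspRows (Γ : Subgroup SL2R) [Countable Γ] (a : SL2R) :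
    (cuspRows Γ a).Countable := by
  have : cuspRows Γ a = range fun γ : Γ => lowerRow (a⁻¹ * γ) := by
    ext p
    simp [cuspRows]
  rw [this]
  exact countable_range _

theorem rowMul_ne_zero {Γ : Subgroup SL2R} {a : SL2R} {p : ℝ × ℝ} (hp : p ∈ cuspRows Γ a)
    (h : SL2R) : rowMul p h ≠ 0 := by
  obtain ⟨γ, -, rfl⟩ := hp
  rw [rowMul_lowerRow]
  exact lowerRow_ne_zero _

/-- The unipotent matrix fixing the row vector `p`. -/
def rowUnipotent (p : ℝ × ℝ) : SL2R :=
  ⟨!![1 + p.1 * p.2, p.2 ^ 2; -p.1 ^ 2, 1 - p.1 * p.2], by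
    rw [Matrix.det_fin_two_of]; ring⟩

/-- The conjugate of the unit unipotent by `A` depends only on the lower row of `A`. This turns rows
into elements of Γ. -/
theorem upperMatrix_one_mul (A : SL2R) :
    upperMatrix 1 * A = A * rowUnipotent (lowerRow A) := by
  have h := SL2R.det_entries A
  have e00 : rowUnipotent (lowerRow A) 0 0 = 1 + A 1 0 * A 1 1 := rfl
  have e01 : rowUnipotent (lowerRow A) 0 1 = A 1 1 ^ 2 := rfl
  have e10 : rowUnipotent (lowerRow A) 1 0 = -A 1 0 ^ 2 := rfl
  have e11 : rowUnipotent (lowerRow A) 1 1 = 1 - A 1 0 * A 1 1 := rfl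
  apply SL2R.ext_entries <;> simp only [SL2R.mul_entry, e00, e01, e10, e11, upperMatrix_00,
    upperMatrix_01, upperMatrix_10, upperMatrix_11]
  · linear_combination -A 1 0 * h
  · linear_combination -A 1 1 * h
  · ring
  · ring

/-- Each row p gives the element `rowUnipotent p` of Γ, conjugate to the generator at the cusp.
Bounded p gives bounded entries, which a discrete group has only finitely many of, and the squares
off the diagonal recover p up to signs. -/
theorem finite_cuspRows_le (Γ : Subgroup SL2R) [DiscreteTopology Γ] {a : SL2R}
    (ha : a * upperMatrix 1 * a⁻¹ ∈ Γ) (B : ℝ) :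
    {p ∈ cuspRows Γ a | |p.1| ≤ B ∧ |p.2| ≤ B}.Finite := by
  have hfib : ∀ M : SL2R, (rowUnipotent ⁻¹' {M}).Finite := by
    intro M
    refine ((Set.toFinite {√(-M 1 0), -√(-M 1 0)}).prod
      (Set.toFinite {√(M 0 1), -√(M 0 1)})).subset ?_
    rintro p rfl
    have e01 : rowUnipotent p 0 1 = p.2 ^ 2 := rfl
    have e10 : -rowUnipotent p 1 0 = p.1 ^ 2 := by
      rw [show rowUnipotent p 1 0 = -p.1 ^ 2 from rfl, neg_neg]
    rw [e01, e10, Real.sqrt_sq_eq_abs, Real.sqrt_sq_eq_abs]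
    constructor
    · rcases abs_choice p.1 with h | h <;> simp [h]
    · rcases abs_choice p.2 with h | h <;> simp [h]
  refine ((finite_subgroup_entries_le Γ (1 + B ^ 2)).preimage' fun M _ => hfib M).subset ?_
  rintro p ⟨⟨γ, hγ, rfl⟩, h1, h2⟩
  have hB : 0 ≤ B := (abs_nonneg _).trans h1
  refine ⟨?_, ?_⟩
  · have h := upperMatrix_one_mul (a⁻¹ * γ)
    have h' : rowUnipotent (lowerRow (a⁻¹ * γ)) = γ⁻¹ * (a * upperMatrix 1 * a⁻¹) * γ := by
      rw [← inv_mul_eq_iff_eq_mul] at h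
      rw [← h]
      group
    rw [h']
    exact Γ.mul_mem (Γ.mul_mem (Γ.inv_mem hγ) ha) hγ
  · generalize lowerRow (a⁻¹ * γ) = p at h1 h2
    have s1 : p.1 ^ 2 ≤ B ^ 2 := sq_le_sq.2 (by rwa [abs_of_nonneg hB])
    have s2 : p.2 ^ 2 ≤ B ^ 2 := sq_le_sq.2 (by rwa [abs_of_nonneg hB])
    have s3 : |p.1 * p.2| ≤ B ^ 2 := by
      rw [abs_mul, sq]
      exact mul_le_mul h1 h2 (abs_nonneg _) hB
    have s4 := abs_le.1 s3
    intro i j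
    rw [abs_le]
    fin_cases i <;> fin_cases j
    · change -_ ≤ 1 + p.1 * p.2 ∧ 1 + p.1 * p.2 ≤ _
      constructor <;> nlinarith
    · change -_ ≤ p.2 ^ 2 ∧ p.2 ^ 2 ≤ _
      constructor <;> nlinarith
    · change -_ ≤ -p.1 ^ 2 ∧ -p.1 ^ 2 ≤ _
      constructor <;> nlinarith
    · change -_ ≤ 1 - p.1 * p.2 ∧ 1 - p.1 * p.2 ≤ _
      constructor <;> nlinarith

/-- Since h has determinant one, p is recovered from `p h` with control by the entries of h. One
finite set therefore serves all h in a compact set, as semicontinuity requires. -/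
theorem finite_cuspRows_rowMul_le (Γ : Subgroup SL2R) [DiscreteTopology Γ] {a : SL2R}
    (ha : a * upperMatrix 1 * a⁻¹ ∈ Γ) (B C : ℝ) :
    {p ∈ cuspRows Γ a | ∃ h : SL2R, (∀ i j, |h i j| ≤ C) ∧
      |(rowMul p h).1| ≤ B ∧ |(rowMul p h).2| ≤ B}.Finite := by
  refine (finite_cuspRows_le Γ ha (2 * B * C)).subset ?_
  rintro p ⟨hp, h, hC, h1, h2⟩
  have hB : 0 ≤ B := (abs_nonneg _).trans h1
  refine ⟨hp, ?_, ?_⟩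
  · rw [fst_eq_of_rowMul p h]
    refine (abs_sub _ _).trans ?_
    rw [abs_mul, abs_mul]
    have := mul_le_mul h1 (hC 1 1) (abs_nonneg _) hB
    have := mul_le_mul h2 (hC 1 0) (abs_nonneg _) hB
    linarith
  · rw [snd_eq_of_rowMul p h]
    refine (abs_sub _ _).trans ?_
    rw [abs_mul, abs_mul]
    have := mul_le_mul h2 (hC 0 0) (abs_nonneg _) hB
    have := mul_le_mul h1 (hC 0 1) (abs_nonneg _) hB
    linarith

/-! ### Hits of the section in terms of row vectors -/

section Hits

variable (Γ : Subgroup SL2R) {K : ℕ} (g : Fin K → SL2R) (σ : Fin K → ℝ)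

/-- Lying on the section after time r means that `g_κ⁻¹ γ h` is the cell element with coordinates
(r, s, t) for some γ ∈ Γ, s and t ≥ σ_κ. Its lower row is `e^{-t/2} (r, 1)`, and s is unconstrained
because the horocycle is complete, so only this row matters. -/
theorem unstableFlow_mem_multiSection_iff (h : SL2R) (r : ℝ) :
    unstableFlow Γ r (toCoset Γ h) ∈ multiSection Γ g σ 0 ↔
      ∃ κ, ∃ p ∈ cuspRows Γ (g κ), (rowMul p h).1 = r * (rowMul p h).2 ∧
        0 < (rowMul p h).2 ∧ (rowMul p h).2 ≤ Real.exp (-σ κ / 2) := by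
  simp only [multiSection, cuspSection, cuspHorocycle, mem_iUnion, mem_image, mem_range, mem_Ici,
    exists_prop, exists_exists_eq_and, stableFlow_toCoset, geodesicFlow_toCoset,
    unstableFlow_toCoset, add_zero, toCoset_eq_iff]
  refine exists_congr fun κ => ⟨?_, ?_⟩
  · rintro ⟨t, ht, s, γ, hγ, e⟩
    have hA : (g κ)⁻¹ * γ⁻¹ * h = cell (r, s, t) := by
      rw [cell, lowerMatrix_neg, eq_mul_inv_iff_mul_eq, mul_assoc, ← e]
      group
    refine ⟨_, ⟨γ⁻¹, Γ.inv_mem hγ, rfl⟩, ?_⟩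
    rw [rowMul_lowerRow, hA]
    simp only [lowerRow, cell_10, cell_11, true_and]
    refine ⟨Real.exp_pos _, Real.exp_le_exp.2 (by linarith)⟩
  · rintro ⟨p, ⟨γ, hγ, rfl⟩, h1, h2, h3⟩
    rw [rowMul_lowerRow] at h1 h2 h3
    set A := (g κ)⁻¹ * γ * h with hA
    simp only [lowerRow] at h1 h2 h3
    refine ⟨-2 * Real.log (A 1 1), ?_, A 0 1 / A 1 1, γ⁻¹, Γ.inv_mem hγ, ?_⟩
    · have := Real.log_le_log h2 h3
      rw [Real.log_exp] at this
      linarith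
    · have hc := cell_cellCoord h2
      rw [cellCoord, h1, mul_div_cancel_right₀ _ h2.ne', cell] at hc
      dsimp only at hc
      rw [lowerMatrix_neg, mul_inv_eq_iff_eq_mul] at hc
      rw [mul_assoc (g κ), hc, hA]
      group

/-- The point `g_κ h⁻_s φ_t` of `SL(2, ℝ)` over the point of the section with parameter `w`. -/
def sectionPoint (w : ℝ × ℝ × Fin K) : SL2R :=
  g w.2.2 * upperMatrix w.1 * diagMatrix w.2.1

theorem param_zero (w : ℝ × ℝ × Fin K) : param Γ g 0 w = toCoset Γ (sectionPoint g w) := by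
  simp [param, sectionPoint]

theorem continuous_sectionPoint : Continuous (sectionPoint g) := by
  unfold sectionPoint
  have : Continuous g := continuous_of_discreteTopology
  fun_prop

/-- The stable horocycle leaves the first coordinate alone and the geodesic flow rescales it, so its
vanishing is constant along a sheet. -/
theorem rowMul_sectionPoint_fst (p : ℝ × ℝ) (w : ℝ × ℝ × Fin K) :
    (rowMul p (sectionPoint g w)).1 = (rowMul p (g w.2.2)).1 * Real.exp (w.2.1 / 2) := by
  rw [sectionPoint, rowMul_mul, rowMul_mul]
  simp [rowMul]

/-- The set of positive times at which the orbit `r ↦ h⁺_{ε r} (x)` is in the section. -/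
def hitSet (ε : ℝ) (x : CosetSpace Γ) : Set ℝ :=
  {r | 0 < r ∧ unstableFlow Γ (ε * r) x ∈ multiSection Γ g σ 0}

/-- The first hitting time for the orbit `r ↦ h⁺_{ε r} (x)`. -/
def firstHit (ε : ℝ) (x : CosetSpace Γ) : ENNReal :=
  ⨅ r ∈ hitSet Γ g σ ε x, ENNReal.ofReal r

theorem hittingTime_eq_firstHit (x : CosetSpace Γ) :
    hittingTime Γ g σ 0 x = firstHit Γ g σ 1 x := by
  simp [hittingTime, firstHit, hitSet]

theorem backwardHittingTime_eq_firstHit (x : CosetSpace Γ) :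
    backwardHittingTime Γ g σ 0 x = firstHit Γ g σ (-1) x := by
  simp [backwardHittingTime, firstHit, hitSet]

variable {Γ g σ}

theorem firstHit_le {ε r : ℝ} {x : CosetSpace Γ} (h : r ∈ hitSet Γ g σ ε x) :
    firstHit Γ g σ ε x ≤ ENNReal.ofReal r := iInf₂_le r h

theorem mem_hitSet_toCoset {ε : ℝ} (hε : ε * ε = 1) {h : SL2R} {r : ℝ} :
    r ∈ hitSet Γ g σ ε (toCoset Γ h) ↔ 0 < r ∧ ∃ κ, ∃ p ∈ cuspRows Γ (g κ),
      ε * (rowMul p h).1 = r * (rowMul p h).2 ∧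
        0 < (rowMul p h).2 ∧ (rowMul p h).2 ≤ Real.exp (-σ κ / 2) := by
  rw [hitSet, mem_ofPred_eq, unstableFlow_mem_multiSection_iff]
  have : ∀ x y : ℝ, x = ε * r * y ↔ ε * x = r * y := by
    intro x y
    constructor
    · rintro rfl
      linear_combination r * y * hε
    · intro h
      linear_combination ε * h - x * hε
  simp only [this]

theorem IsCuspSystem.mul_upperMatrix_mem_iff (hg : IsCuspSystem Γ g) (κ : Fin K) (s : ℝ) :
    g κ * upperMatrix s * (g κ)⁻¹ ∈ Γ ↔ ∃ n : ℤ, s = n := by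
  rw [← hg.length_one κ s, stableFlow_toCoset, eq_comm, toCoset_eq_iff]
  constructor
  · intro h
    exact ⟨_, h, by simp⟩
  · rintro ⟨γ, hγ, h⟩
    rw [← h]
    simpa using hγ

theorem IsCuspSystem.conj_upperMatrix_one_mem (hg : IsCuspSystem Γ g) (κ : Fin K) :
    g κ * upperMatrix 1 * (g κ)⁻¹ ∈ Γ :=
  (hg.mul_upperMatrix_mem_iff κ 1).2 ⟨1, by simp⟩

/-- The hitting times form a locally finite set. -/
theorem finite_hitSet_inter_Iic [DiscreteTopology Γ] (hg : IsCuspSystem Γ g) {ε : ℝ}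
    (hε : ε * ε = 1) (x : CosetSpace Γ) (r₀ : ℝ) :
    (hitSet Γ g σ ε x ∩ Iic r₀).Finite := by
  obtain ⟨h, rfl⟩ := toCoset_surjective Γ x
  obtain ⟨C, hC⟩ : ∃ C, ∀ i j, |h i j| ≤ C :=
    ⟨∑ i, ∑ j, |h i j|, fun i j =>
      (Finset.single_le_sum (f := fun j => |h i j|) (fun _ _ => abs_nonneg _)
        (Finset.mem_univ j)).trans
      (Finset.single_le_sum (f := fun i => ∑ j, |h i j|)
        (fun _ _ => Finset.sum_nonneg fun _ _ => abs_nonneg _) (Finset.mem_univ i))⟩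
  -- A hit by time r₀ has y ≤ `e^{-σ_κ/2}` and |x| = r y, so the factor `max 1 r₀` bounds both
  -- coordinates.
  let B (κ : Fin K) : ℝ := max 1 r₀ * Real.exp (-σ κ / 2)
  refine (Set.finite_iUnion fun κ => (finite_cuspRows_rowMul_le Γ
    (hg.conj_upperMatrix_one_mem κ) (B κ) C).image
      fun p => ε * (rowMul p h).1 / (rowMul p h).2).subset ?_
  rintro r ⟨hr, hr₀⟩
  obtain ⟨h0, κ, p, hp, h1, h2, h3⟩ := (mem_hitSet_toCoset hε).1 hr
  have hr₀' : r ≤ r₀ := hr₀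
  refine mem_iUnion.2 ⟨κ, p, ⟨hp, h, hC, ?_, ?_⟩, ?_⟩
  · have hε' : |ε| = 1 := by
      rcases mul_self_eq_one_iff.1 hε with h | h <;> simp [h]
    have : |(rowMul p h).1| = r * (rowMul p h).2 := by
      rw [← abs_of_pos (mul_pos h0 h2), ← h1, abs_mul, hε', one_mul]
    rw [this]
    exact mul_le_mul (hr₀'.trans (le_max_right _ _)) h3 h2.le (by positivity)
  · rw [abs_of_pos h2]
    exact h3.trans (le_mul_of_one_le_left (Real.exp_pos _).le (le_max_left _ _))
  · dsimp only
    rw [h1, mul_div_cancel_right₀ _ h2.ne']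

theorem exists_isLeast_hitSet [DiscreteTopology Γ] (hg : IsCuspSystem Γ g) {ε : ℝ}
    (hε : ε * ε = 1) {x : CosetSpace Γ} (hx : (hitSet Γ g σ ε x).Nonempty) :
    ∃ r, IsLeast (hitSet Γ g σ ε x) r := by
  obtain ⟨r₀, h₀⟩ := hx
  obtain ⟨r, hr, hmin⟩ := Set.exists_min_image _ id (finite_hitSet_inter_Iic hg hε x r₀)
    ⟨r₀, h₀, le_refl r₀⟩
  refine ⟨r, hr.1, fun r' hr' => ?_⟩
  by_cases h : r' ≤ r₀
  · exact hmin r' ⟨hr', h⟩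
  · exact le_trans hr.2 (not_le.1 h).le

theorem firstHit_eq_of_isLeast {ε r : ℝ} {x : CosetSpace Γ}
    (h : IsLeast (hitSet Γ g σ ε x) r) : firstHit Γ g σ ε x = ENNReal.ofReal r :=
  le_antisymm (firstHit_le h.1) (le_iInf₂ fun _ h' => ENNReal.ofReal_le_ofReal (h.2 h'))

/-- Near w₀ only finitely many rows can cause a hit by a given time, and the conditions for a hit
are closed except for y > 0 and r > 0. A row is never zero, which excludes y = 0 in the limit. Times
cannot tend to 0, since a first coordinate vanishing at w₀ vanishes on the whole sheet. -/
theorem lowerSemicontinuous_firstHit_param [DiscreteTopology Γ] (hg : IsCuspSystem Γ g) {ε : ℝ}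
    (hε : ε * ε = 1) : LowerSemicontinuous fun w => firstHit Γ g σ ε (param Γ g 0 w) := by
  intro w₀ c hc
  simp only [param_zero] at hc ⊢
  obtain ⟨r₁, hcr, hr⟩ := ENNReal.lt_iff_exists_nnreal_btwn.1 hc
  set H := sectionPoint g with hH
  have hHc : Continuous H := continuous_sectionPoint g
  have hentry : ∀ i j : Fin 2, ∀ᶠ w in 𝓝 w₀, |H w i j| ≤ (∑ i, ∑ j, |H w₀ i j|) + 1 := by
    intro i j
    have hlt : |H w₀ i j| < (∑ i, ∑ j, |H w₀ i j|) + 1 :=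
      ((Finset.single_le_sum (f := fun j => |H w₀ i j|) (fun _ _ => abs_nonneg _)
        (Finset.mem_univ j)).trans
      (Finset.single_le_sum (f := fun i => ∑ j, |H w₀ i j|)
        (fun _ _ => Finset.sum_nonneg fun _ _ => abs_nonneg _) (Finset.mem_univ i))).trans_lt
        (lt_add_one _)
    have hcont : Continuous fun w => |H w i j| := ((continuous_entry i j).comp hHc).abs
    exact (hcont.tendsto w₀).eventually_le_const hlt
  set C := (∑ i, ∑ j, |H w₀ i j|) + 1
  let B (κ : Fin K) : ℝ := max 1 (r₁ : ℝ) * Real.exp (-σ κ / 2)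
  let Q (κ : Fin K) := {p ∈ cuspRows Γ (g κ) | ∃ h : SL2R, (∀ i j, |h i j| ≤ C) ∧
      |(rowMul p h).1| ≤ B κ ∧ |(rowMul p h).2| ≤ B κ}
  have hQ (κ : Fin K) : (Q κ).Finite :=
    finite_cuspRows_rowMul_le Γ (hg.conj_upperMatrix_one_mem κ) (B κ) C
  have hsheet : ∀ᶠ w : ℝ × ℝ × Fin K in 𝓝 w₀, w.2.2 = w₀.2.2 := by
    have : Continuous fun w : ℝ × ℝ × Fin K => w.2.2 := by fun_prop
    exact (isOpen_discrete {w₀.2.2}).preimage this |>.mem_nhds rfl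
  have hrow : ∀ κ, ∀ p ∈ Q κ, ∀ᶠ w in 𝓝 w₀, ¬ (0 ≤ (rowMul p (H w)).2 ∧
      (rowMul p (H w)).2 ≤ Real.exp (-σ κ / 2) ∧ 0 < ε * (rowMul p (H w)).1 ∧
      ε * (rowMul p (H w)).1 ≤ r₁ * (rowMul p (H w)).2) := by
    intro κ p hp
    -- If one row caused hits arbitrarily near w₀, the closed form of the conditions would hold at
    -- w₀ itself.
    by_contra hcon
    have hfreq := Filter.not_eventually.1 hcon
    simp only [not_not] at hfreq
    have hx : Continuous fun w => ε * (rowMul p (H w)).1 := by fun_prop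
    have hy : Continuous fun w => (rowMul p (H w)).2 := by fun_prop
    have hclosed : IsClosed {w | 0 ≤ (rowMul p (H w)).2 ∧
        (rowMul p (H w)).2 ≤ Real.exp (-σ κ / 2) ∧ 0 ≤ ε * (rowMul p (H w)).1 ∧
        ε * (rowMul p (H w)).1 ≤ r₁ * (rowMul p (H w)).2} :=
      (isClosed_le continuous_const hy).inter ((isClosed_le hy continuous_const).inter
        ((isClosed_le continuous_const hx).inter (isClosed_le hx (continuous_const.mul hy))))
    obtain ⟨hy0, hyδ, hx0, hxy⟩ := hclosed.mem_of_frequently_of_tendsto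
      (hfreq.mono fun w hw => ⟨hw.1, hw.2.1, hw.2.2.1.le, hw.2.2.2⟩) tendsto_id
    have hε0 : ε ≠ 0 := fun h => by simp [h] at hε
    have hypos : 0 < (rowMul p (H w₀)).2 := by
      refine lt_of_le_of_ne hy0 fun h => ?_
      change _ ≤ _ * (rowMul p (H w₀)).2 at hxy
      rw [← h, mul_zero] at hxy
      have : ε * (rowMul p (H w₀)).1 = 0 := le_antisymm hxy hx0
      exact rowMul_ne_zero hp.1 (H w₀)
        (Prod.ext ((mul_eq_zero.1 this).resolve_left hε0) h.symm)
    -- Either the limiting time is 0, which is impossible on a sheet, or w₀ is itself hit by time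
    -- r₁, against the choice of r₁.
    rcases hx0.eq_or_lt with h0 | hpos
    · obtain ⟨w, hw, hκ⟩ := (hfreq.and_eventually hsheet).exists
      have h1 : (rowMul p (H w₀)).1 = 0 := (mul_eq_zero.1 h0.symm).resolve_left hε0
      rw [hH, rowMul_sectionPoint_fst, mul_eq_zero] at h1
      have h2 := h1.resolve_right (Real.exp_pos _).ne'
      have h3 := hw.2.2.1
      rw [hH, rowMul_sectionPoint_fst, hκ, h2] at h3
      simp at h3
    · have hmem : ε * (rowMul p (H w₀)).1 / (rowMul p (H w₀)).2 ∈
          hitSet Γ g σ ε (toCoset Γ (H w₀)) :=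
        (mem_hitSet_toCoset hε).2 ⟨div_pos hpos hypos, κ, p, hp.1, by
          rw [div_mul_cancel₀ _ hypos.ne'], hypos, hyδ⟩
      have hle := firstHit_le hmem
      have hle2 : ENNReal.ofReal (ε * (rowMul p (H w₀)).1 / (rowMul p (H w₀)).2) ≤ r₁ := by
        rw [← ENNReal.ofReal_coe_nnreal]
        exact ENNReal.ofReal_le_ofReal ((div_le_iff₀ hypos).2 hxy)
      exact absurd hr (not_lt.2 (hle.trans hle2))
  have hall : ∀ᶠ w in 𝓝 w₀, ∀ κ, ∀ p ∈ Q κ, ¬ (0 ≤ (rowMul p (H w)).2 ∧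
      (rowMul p (H w)).2 ≤ Real.exp (-σ κ / 2) ∧ 0 < ε * (rowMul p (H w)).1 ∧
      ε * (rowMul p (H w)).1 ≤ r₁ * (rowMul p (H w)).2) :=
    eventually_all.2 fun κ => (eventually_all_finite (hQ κ)).2 (hrow κ)
  filter_upwards [hall, eventually_all.2 fun i => eventually_all.2 (hentry i)] with w hw hC
  refine hcr.trans_le (le_iInf₂ fun r hrm => ?_)
  by_contra hlt
  have hrr : r ≤ r₁ := by
    rw [← ENNReal.ofReal_coe_nnreal, ENNReal.ofReal_le_ofReal_iff'] at hlt
    push Not at hlt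
    exact hlt.1.le
  obtain ⟨h0, κ, p, hp, h1, h2, h3⟩ := (mem_hitSet_toCoset hε).1 hrm
  have hε' : |ε| = 1 := by
    rcases mul_self_eq_one_iff.1 hε with h | h <;> simp [h]
  refine hw κ p ⟨hp, H w, hC, ?_, ?_⟩ ⟨h2.le, h3, ?_, ?_⟩
  · have : |(rowMul p (H w)).1| = r * (rowMul p (H w)).2 := by
      rw [← abs_of_pos (mul_pos h0 h2), ← h1, abs_mul, hε', one_mul]
    rw [this]
    exact mul_le_mul (hrr.trans (le_max_right _ _)) h3 h2.le (by positivity)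
  · rw [abs_of_pos h2]
    exact h3.trans (le_mul_of_one_le_left (Real.exp_pos _).le (le_max_left _ _))
  · rw [h1]
    exact mul_pos h0 h2
  · rw [h1]
    exact mul_le_mul_of_nonneg_right hrr h2.le

theorem endpoint_mul_upper_diag (a : SL2R) (s t : ℝ) :
    endpoint (a * upperMatrix s * diagMatrix t) = endpoint a := by
  simp only [endpoint, mul_assoc, map_mul, mul_smul]
  congr 1
  rw [← mul_smul, ← map_mul, OnePoint.smul_infty_eq_self_iff]
  change (upperMatrix s * diagMatrix t) 1 0 = 0
  simp [SL2R.mul_entry]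

/-- The section is parametrised injectively. -/
theorem IsCuspSystem.injOn_param (hg : IsCuspSystem Γ g) :
    InjOn (param Γ g 0) (paramDomain σ) := by
  rintro ⟨s, t, κ⟩ ⟨hs, -⟩ ⟨s', t', κ'⟩ ⟨hs', -⟩ h
  rw [param_zero, param_zero, toCoset_eq_iff] at h
  obtain ⟨γ, hγ, h⟩ := h
  simp only [sectionPoint] at h
  dsimp only at hs hs'
  -- The flows φ and h⁻ fix the forward endpoint, so γ identifies the parabolic fixed points of the
  -- two cusps.
  have hκ : κ = κ' := by
    have he : Matrix.SpecialLinearGroup.toGL γ • endpoint (g κ) = endpoint (g κ') := by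
      rw [← endpoint_mul_upper_diag (g κ) s t, ← endpoint_mul_upper_diag (g κ') s' t', ← h]
      simp only [endpoint, map_mul, mul_smul]
    exact (hg.existsUnique _ (hg.isCusp κ)).unique ⟨1, Γ.one_mem, by simp⟩ ⟨γ, hγ, he⟩
  subst hκ
  -- Conjugation by γ dilates the unipotent group at the cusp by `e^{t'-t}`. It preserves the
  -- lattice of integer periods, so this factor and its inverse are both integers, which forces t' =
  -- t.
  have hconj (u : ℝ) : γ * (g κ * upperMatrix u * (g κ)⁻¹) * γ⁻¹ =
      g κ * upperMatrix (Real.exp (t' - t) * u) * (g κ)⁻¹ := by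
    have e1 : γ = g κ * (upperMatrix s' * diagMatrix (t' - t) * upperMatrix (-s)) * (g κ)⁻¹ := by
      rw [← mul_right_cancel_iff (a := g κ * upperMatrix s * diagMatrix t)]
      rw [h, sub_eq_add_neg, diagMatrix_add, diagMatrix_neg, upperMatrix_neg]
      group
    have e2 : diagMatrix (t' - t) * upperMatrix u * (diagMatrix (t' - t))⁻¹ =
        upperMatrix (Real.exp (t' - t) * u) := by
      rw [diagMatrix_mul_upperMatrix, mul_inv_cancel_right]
    have e3 : upperMatrix (-s) * upperMatrix u * (upperMatrix (-s))⁻¹ = upperMatrix u := by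
      rw [← upperMatrix_neg, ← upperMatrix_add, ← upperMatrix_add]
      ring_nf
    have e4 (v : ℝ) : upperMatrix s' * upperMatrix v * (upperMatrix s')⁻¹ = upperMatrix v := by
      rw [← upperMatrix_neg, ← upperMatrix_add, ← upperMatrix_add]
      ring_nf
    rw [e1]
    calc _ = g κ * (upperMatrix s' * (diagMatrix (t' - t) * (upperMatrix (-s) * upperMatrix u *
          (upperMatrix (-s))⁻¹) * (diagMatrix (t' - t))⁻¹) * (upperMatrix s')⁻¹) * (g κ)⁻¹ := by
            group
      _ = _ := by rw [e3, e2, e4]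
  obtain ⟨n, hn⟩ : ∃ n : ℤ, Real.exp (t' - t) = n := by
    have := hconj 1
    rw [mul_one] at this
    rw [← hg.mul_upperMatrix_mem_iff κ, ← this]
    exact Γ.mul_mem (Γ.mul_mem hγ (hg.conj_upperMatrix_one_mem κ)) (Γ.inv_mem hγ)
  obtain ⟨n', hn'⟩ : ∃ n : ℤ, Real.exp (-(t' - t)) = n := by
    have := hconj (Real.exp (-(t' - t)))
    rw [← Real.exp_add, add_neg_cancel, Real.exp_zero] at this
    rw [← hg.mul_upperMatrix_mem_iff κ]
    have h2 : g κ * upperMatrix (Real.exp (-(t' - t))) * (g κ)⁻¹ =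
        γ⁻¹ * (g κ * upperMatrix 1 * (g κ)⁻¹) * γ := by
      rw [← this]
      group
    rw [h2]
    exact Γ.mul_mem (Γ.mul_mem (Γ.inv_mem hγ) (hg.conj_upperMatrix_one_mem κ)) hγ
  have hnn : n * n' = 1 := by
    have : (n : ℝ) * n' = 1 := by
      rw [← hn, ← hn', ← Real.exp_add]
      simp
    exact_mod_cast this
  have hn1 : n = 1 := by
    rcases Int.mul_eq_one_iff_eq_one_or_neg_one.1 hnn with h | h
    · exact h.1
    · have := Real.exp_pos (t' - t)
      rw [hn, h.1] at this
      norm_num at this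
  have ht : t' = t := by
    rw [hn1, Int.cast_one, Real.exp_eq_one_iff] at hn
    linarith
  subst ht
  have h' : γ = g κ * upperMatrix (s' - s) * (g κ)⁻¹ := by
    have h2 := mul_right_cancel ((mul_assoc γ _ _).trans h)
    rw [sub_eq_add_neg, upperMatrix_add, upperMatrix_neg, ← mul_assoc, ← h2]
    group
  obtain ⟨k, hk⟩ := (hg.mul_upperMatrix_mem_iff κ (s' - s)).1 (h' ▸ hγ)
  have hk0 : k = 0 := by
    have h1 : (k : ℝ) < 1 := by rw [← hk]; linarith [hs.1, hs'.2]
    have h2 : (-1 : ℝ) < k := by rw [← hk]; linarith [hs.2, hs'.1]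
    have h1' : k < 1 := by exact_mod_cast h1
    have h2' : -1 < k := by exact_mod_cast h2
    omega
  rw [hk0, Int.cast_zero, sub_eq_zero] at hk
  rw [hk]

end Hits

/-! ### Almost every orbit hits the section -/

theorem countable_of_discrete (Γ : Subgroup SL2R) [DiscreteTopology Γ] : Countable Γ :=
  TopologicalSpace.separableSpace_iff_countable.1 inferInstance

/-- Right translations preserve the measure on the quotient induced by a Haar measure. -/
theorem measure_preimage_mul_right_inter {Γ : Subgroup SL2R} [Countable Γ] {m : Measure SL2R}
    [m.IsHaarMeasure] {F : Set SL2R} (hF : IsFundamentalDomain Γ F m) {a : SL2R}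
    (ha : Measure.modularCharacter a = 1) {S : Set SL2R} (hS : MeasurableSet S)
    (hinv : ∀ γ ∈ Γ, (fun h => γ * h) ⁻¹' S = S) :
    m ((fun h => h * a) ⁻¹' S ∩ F) = m (S ∩ F) := by
  have ha' : Measure.modularCharacter a⁻¹ = 1 := by
    have := map_mul Measure.modularCharacter a a⁻¹
    rwa [mul_inv_cancel, map_one, ha, one_mul, eq_comm] at this
  have hF' : IsFundamentalDomain Γ ((fun h => h * a⁻¹) ⁻¹' F) m :=
    hF.preimage_of_equiv
      (measurePreserving_mul_right_of_modularCharacter_eq_one m ha').quasiMeasurePreserving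
      (e := id) Function.bijective_id fun γ h => by
        change (γ : SL2R) * h * a⁻¹ = γ * (h * a⁻¹)
        rw [mul_assoc]
  have h1 : (fun h => h * a) ⁻¹' S ∩ F = (fun h => h * a) ⁻¹' (S ∩ (fun h => h * a⁻¹) ⁻¹' F) := by
    ext h
    simp
  rw [h1, (measurePreserving_mul_right_of_modularCharacter_eq_one m ha).measure_preimage
    (hS.nullMeasurableSet.inter hF'.nullMeasurableSet)]
  exact (hF.measure_set_eq hF' hS fun γ => hinv γ γ.2).symm

theorem measure_iInter_inter_eq_of_antitone {α : Type*} [MeasurableSpace α] {m : Measure α}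
    {F : Set α} (hF : NullMeasurableSet F m) (hmF : m F ≠ ⊤) {S : ℕ → Set α}
    (hS : ∀ n, MeasurableSet (S n)) (hanti : Antitone S) {c : ENNReal}
    (hc : ∀ n, m (S n ∩ F) = c) : m ((⋂ n, S n) ∩ F) = c := by
  have h := tendsto_measure_iInter_atTop (μ := m) (s := fun n => S n ∩ F)
    (fun n => (hS n).nullMeasurableSet.inter hF)
    (fun i j hij => inter_subset_inter_left _ (hanti hij))
    ⟨0, measure_ne_top_of_subset inter_subset_right hmF⟩
  rw [← iInter_inter] at h
  refine tendsto_nhds_unique h ?_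
  simp only [Function.comp_def, hc]
  exact tendsto_const_nhds

/-- The right translates of the zero set by distinct upper unipotents are disjoint and have equal
measure. Uncountably many disjoint sets of equal positive measure cannot exist for a σ-finite
measure. -/
theorem measure_lower_right_entry_eq_zero (m : Measure SL2R) [m.IsHaarMeasure] (a : SL2R) :
    m {h : SL2R | (a * h) 1 1 = 0} = 0 := by
  have h0 : m {h : SL2R | h 1 1 = 0} = 0 := by
    have hZ : MeasurableSet {h : SL2R | h 1 1 = 0} :=
      (isClosed_singleton (x := (0 : ℝ))).preimage (continuous_entry 1 1) |>.measurableSet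
    let Z (u : ℝ) : Set SL2R := (fun h => h * upperMatrix u) ⁻¹' {h : SL2R | h 1 1 = 0}
    have hZm (u : ℝ) : m (Z u) = m {h : SL2R | h 1 1 = 0} :=
      (measurePreserving_mul_right_of_modularCharacter_eq_one m
        (modularCharacter_upperMatrix u)).measure_preimage hZ.nullMeasurableSet
    have hcount := Measure.countable_meas_pos_of_disjoint_iUnion (μ := m) (As := Z)
      (fun u => (continuous_mul_const (upperMatrix u)).measurable hZ) (by
        intro u v huv
        refine Set.disjoint_left.2 fun h hu hv => huv ?_
        change (h * upperMatrix u) 1 1 = 0 at hu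
        change (h * upperMatrix v) 1 1 = 0 at hv
        simp only [SL2R.mul_entry, upperMatrix_01, upperMatrix_11, mul_one] at hu hv
        have hd := SL2R.det_entries h
        have hne : h 1 0 ≠ 0 := by
          intro h0
          rw [h0] at hd hu
          rw [zero_mul, zero_add] at hu
          rw [hu] at hd
          simp at hd
        apply mul_left_cancel₀ hne
        linarith)
    by_contra hpos
    simp only [hZm] at hcount
    have huniv : {u : ℝ | 0 < m {h : SL2R | h 1 1 = 0}} = univ :=
      Set.eq_univ_of_forall fun _ => pos_iff_ne_zero.2 hpos
    rw [huniv] at hcount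
    exact Cardinal.not_countable_real hcount
  rw [← h0]
  exact measure_preimage_mul m a {h : SL2R | h 1 1 = 0}

theorem rowMul_mul_diagMatrix (p : ℝ × ℝ) (h : SL2R) (t : ℝ) :
    rowMul p (h * diagMatrix t) =
      ((rowMul p h).1 * Real.exp (t / 2), (rowMul p h).2 * Real.exp (-t / 2)) := by
  rw [rowMul_mul]
  simp [rowMul]

theorem rowMul_mul_lowerMatrix (p : ℝ × ℝ) (h : SL2R) (s : ℝ) :
    rowMul p (h * lowerMatrix s) = ((rowMul p h).1 - s * (rowMul p h).2, (rowMul p h).2) := by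
  rw [rowMul_mul]
  ext <;> simp [rowMul]
  ring

section

variable {Γ : Subgroup SL2R} {a : SL2R}

/-- The set of `h` such that no vector `p h`, `p` a row of the cusp, lies in `T`. -/
def avoiding (Γ : Subgroup SL2R) (a : SL2R) (T : Set (ℝ × ℝ)) : Set SL2R :=
  {h | ∀ p ∈ cuspRows Γ a, rowMul p h ∉ T}

theorem measurableSet_avoiding [Countable Γ] {T : Set (ℝ × ℝ)} (hT : MeasurableSet T) :
    MeasurableSet (avoiding Γ a T) := by
  have : avoiding Γ a T = ⋂ p ∈ cuspRows Γ a, (rowMul p ⁻¹' T)ᶜ := by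
    ext h
    simp [avoiding]
  rw [this]
  exact MeasurableSet.biInter (countable_cuspRows Γ a) fun p _ =>
    ((continuous_rowMul p).measurable hT).compl

theorem preimage_mul_left_avoiding (T : Set (ℝ × ℝ)) :
    ∀ γ ∈ Γ, (fun h => γ * h) ⁻¹' avoiding Γ a T = avoiding Γ a T := by
  have key : ∀ γ ∈ Γ, ∀ h ∈ avoiding Γ a T, γ * h ∈ avoiding Γ a T := by
    intro γ hγ h hh p hp
    rw [rowMul_mul]
    exact hh _ (rowMul_mem_cuspRows hp hγ)
  intro γ hγ
  ext h
  refine ⟨fun hh => ?_, fun hh => key γ hγ h hh⟩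
  have := key γ⁻¹ (Γ.inv_mem hγ) _ hh
  simpa using this

/-- For almost every `h`, some vector `p h` lies in a given half-strip. -/
theorem measure_avoiding_strip_inter_eq_zero [Countable Γ] (hneg : (-1 : SL2R) ∈ Γ)
    {m : Measure SL2R} [m.IsHaarMeasure] {F : Set SL2R} (hF : IsFundamentalDomain Γ F m)
    (hmF : m F ≠ ⊤) {ε : ℝ} (hε : ε * ε = 1) {δ : ℝ} (hδ : 0 < δ) :
    m (avoiding Γ a {v | 0 < v.2 ∧ v.2 ≤ δ ∧ 0 < ε * v.1} ∩ F) = 0 := by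
  let T (δ : ℝ) : Set (ℝ × ℝ) := {v | 0 < v.2 ∧ v.2 ≤ δ ∧ 0 < ε * v.1}
  have hT (δ : ℝ) : MeasurableSet (T δ) :=
    (measurableSet_lt measurable_const measurable_snd).inter
      ((measurableSet_le measurable_snd measurable_const).inter
        (measurableSet_lt measurable_const (measurable_fst.const_mul ε)))
  let Q (u : ℝ) : Set (ℝ × ℝ) := {v | 0 < v.2 ∧ 0 < ε * v.1 + u * v.2}
  have hQ (u : ℝ) : MeasurableSet (Q u) :=
    (measurableSet_lt measurable_const measurable_snd).inter
      (measurableSet_lt measurable_const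
        ((measurable_fst.const_mul ε).add (measurable_snd.const_mul u)))
  -- The geodesic flow widens the strip without changing the measure of the avoiding set. Letting
  -- the width grow replaces the strip by a quadrant, and finiteness of the measure allows the
  -- limit.
  have hstrip (n : ℕ) : m (avoiding Γ a (T (δ * Real.exp n)) ∩ F) = m (avoiding Γ a (T δ) ∩ F) := by
    rw [← measure_preimage_mul_right_inter hF (modularCharacter_diagMatrix (2 * n))
      (measurableSet_avoiding (hT δ)) (preimage_mul_left_avoiding _)]
    congr 2
    ext h
    simp only [avoiding, mem_preimage, mem_ofPred_eq, rowMul_mul_diagMatrix, T]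
    refine forall₂_congr fun p _ => not_congr ?_
    have e1 : (2 * (n : ℝ)) / 2 = n := by ring
    have e2 : -(2 * (n : ℝ)) / 2 = -n := by ring
    rw [e1, e2, Real.exp_neg, ← div_eq_mul_inv, div_le_iff₀ (Real.exp_pos _), ← mul_assoc]
    simp only [Real.exp_pos, div_pos_iff_of_pos_right, mul_pos_iff_of_pos_right]
  have hquad : m (avoiding Γ a (Q 0) ∩ F) = m (avoiding Γ a (T δ) ∩ F) := by
    rw [← measure_iInter_inter_eq_of_antitone hF.nullMeasurableSet hmF
      (fun n : ℕ => measurableSet_avoiding (hT (δ * Real.exp n))) ?_ hstrip]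
    · congr 2
      ext h
      simp only [avoiding, mem_iInter, mem_ofPred_eq, T, Q, zero_mul, add_zero]
      refine ⟨fun hh n p hp hv => hh p hp ⟨hv.1, hv.2.2⟩, fun hh p hp hv => ?_⟩
      obtain ⟨n, hn⟩ := exists_nat_ge ((rowMul p h).2 / δ)
      refine hh n p hp ⟨hv.1, ?_, hv.2⟩
      rw [div_le_iff₀' hδ] at hn
      exact hn.trans (mul_le_mul_of_nonneg_left
        ((le_add_of_nonneg_right zero_le_one).trans (Real.add_one_le_exp _)) hδ.le)
    · intro i j hij h hh p hp hv
      refine hh p hp ⟨hv.1, hv.2.1.trans (mul_le_mul_of_nonneg_left ?_ hδ.le), hv.2.2⟩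
      exact Real.exp_le_exp.2 (by exact_mod_cast hij)
  -- The horocycle flow shears the quadrant into sectors that exhaust the half-plane y > 0.
  have hhalf (n : ℕ) : m (avoiding Γ a (Q n) ∩ F) = m (avoiding Γ a (Q 0) ∩ F) := by
    rw [← measure_preimage_mul_right_inter hF (modularCharacter_lowerMatrix (-(ε * n)))
      (measurableSet_avoiding (hQ 0)) (preimage_mul_left_avoiding _)]
    congr 2
    ext h
    simp only [avoiding, mem_preimage, mem_ofPred_eq, rowMul_mul_lowerMatrix, Q, zero_mul,
      add_zero]
    refine forall₂_congr fun p _ => not_congr ?_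
    have : ε * ((rowMul p h).1 - -(ε * n) * (rowMul p h).2) =
        ε * (rowMul p h).1 + n * (rowMul p h).2 := by
      linear_combination (n * (rowMul p h).2) * hε
    rw [this]
  change m (avoiding Γ a (T δ) ∩ F) = 0
  rw [← hquad, ← measure_iInter_inter_eq_of_antitone hF.nullMeasurableSet hmF
      (fun n : ℕ => measurableSet_avoiding (hQ n)) ?_ hhalf]
  -- Avoiding the whole half-plane means y ≤ 0 for every row. Since -1 ∈ Γ, the negatives are rows
  -- too, so y = 0, which is a null condition on h.
  · refine measure_mono_null ?_ (measure_lower_right_entry_eq_zero m a⁻¹)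
    rintro h ⟨hh, -⟩
    rw [mem_iInter] at hh
    have hp : lowerRow a⁻¹ ∈ cuspRows Γ a := ⟨1, Γ.one_mem, by simp⟩
    have hle : ∀ p ∈ cuspRows Γ a, (rowMul p h).2 ≤ 0 := by
      intro p hp
      by_contra hpos
      have hpos := not_le.1 hpos
      obtain ⟨n, hn⟩ := exists_nat_gt (-(ε * (rowMul p h).1) / (rowMul p h).2)
      rw [div_lt_iff₀ hpos] at hn
      exact hh n p hp ⟨hpos, by linarith⟩
    have h1 := hle _ hp
    have h2 := hle _ (neg_mem_cuspRows hneg hp)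
    have h3 : (rowMul (-lowerRow a⁻¹) h).2 = -(rowMul (lowerRow a⁻¹) h).2 := by
      simp [rowMul]
      ring
    rw [h3] at h2
    have h4 : (rowMul (lowerRow a⁻¹) h).2 = 0 := by linarith
    rwa [rowMul_lowerRow] at h4
  · intro i j hij h hh p hp hv
    refine hh p hp ⟨hv.1, hv.2.trans_le ?_⟩
    have : (i : ℝ) ≤ j := by exact_mod_cast hij
    have := mul_le_mul_of_nonneg_right this hv.1.le
    linarith

end

theorem liouville_apply {Γ : Subgroup SL2R} {m : Measure SL2R} {F : Set SL2R}
    {E : Set (CosetSpace Γ)} (hE : MeasurableSet E) :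
    liouville Γ m F E = m (toCoset Γ ⁻¹' E ∩ F) := by
  have := (continuous_toCoset Γ).measurable
  rw [liouville, Measure.map_apply this hE, Measure.restrict_apply (this hE)]

theorem isProbabilityMeasure_liouville {Γ : Subgroup SL2R} {m : Measure SL2R} {F : Set SL2R}
    (hmF : m F = 1) : IsProbabilityMeasure (liouville Γ m F) :=
  ⟨by rw [liouville_apply MeasurableSet.univ]; simpa using hmF⟩

/-- Almost every orbit of the unstable horocycle flow hits the section, both in forward and in
backward time. -/
theorem ae_nonempty_hitSet {Γ : Subgroup SL2R} [DiscreteTopology Γ] (hneg : (-1 : SL2R) ∈ Γ)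
    {m : Measure SL2R} [m.IsHaarMeasure] {F : Set SL2R} (hF : IsFundamentalDomain Γ F m)
    (hmF : m F = 1) {K : ℕ} (hK : 0 < K) (g : Fin K → SL2R) (σ : Fin K → ℝ)
    {ε : ℝ} (hε : ε * ε = 1) :
    ∀ᵐ h ∂(m.restrict F), (hitSet Γ g σ ε (toCoset Γ h)).Nonempty := by
  have := countable_of_discrete Γ
  have h0 := measure_avoiding_strip_inter_eq_zero (a := g ⟨0, hK⟩) hneg hF (by simp [hmF]) hε
    (Real.exp_pos (-σ ⟨0, hK⟩ / 2))
  rw [← Measure.restrict_apply₀' hF.nullMeasurableSet] at h0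
  rw [ae_iff]
  refine measure_mono_null ?_ h0
  intro h hh p hp hv
  refine hh ⟨ε * (rowMul p h).1 / (rowMul p h).2, (mem_hitSet_toCoset hε).2
    ⟨div_pos hv.2.2 hv.1, ⟨0, hK⟩, p, hp, ?_, hv.1, hv.2.1⟩⟩
  rw [div_mul_cancel₀ _ hv.1.ne']

/-! ### The measure on the section -/

theorem measurableSet_paramDomain {K : ℕ} (σ : Fin K → ℝ) : MeasurableSet (paramDomain σ) := by
  have hσ : Measurable σ := measurable_of_countable σ
  have h1 : MeasurableSet {w : ℝ × ℝ × Fin K | w.1 ∈ Ico (0 : ℝ) 1} :=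
    measurable_fst measurableSet_Ico
  have h2 : MeasurableSet {w : ℝ × ℝ × Fin K | σ w.2.2 ≤ w.2.1} :=
    measurableSet_le (hσ.comp measurable_snd.snd) measurable_snd.fst
  exact h1.inter h2

instance {K : ℕ} : SigmaFinite (sheetLebesgue K) := by
  unfold sheetLebesgue
  infer_instance

instance {K : ℕ} (σ : Fin K → ℝ) : SigmaFinite (sectionMeasure σ) := by
  unfold sectionMeasure
  infer_instance

theorem sectionMeasure_absolutelyContinuous {K : ℕ} (σ : Fin K → ℝ) :
    sectionMeasure σ ≪ sheetLebesgue K :=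
  (withDensity_absolutelyContinuous _ _).trans Measure.restrict_le_self.absolutelyContinuous

theorem ae_mem_paramDomain {K : ℕ} (σ : Fin K → ℝ) :
    ∀ᵐ w ∂(sectionMeasure σ), w ∈ paramDomain σ :=
  (withDensity_absolutelyContinuous _ _).ae_le (ae_restrict_mem (measurableSet_paramDomain σ))

theorem sectionMeasure_apply_eq_sum {K : ℕ} {σ : Fin K → ℝ} {B : Set (ℝ × ℝ × Fin K)}
    (hB : MeasurableSet B) (hBσ : B ⊆ paramDomain σ) :
    sectionMeasure σ B =
      ∑ κ, (volume : Measure ℝ).prod expMeasure {z | (z.1, z.2, κ) ∈ B} := by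
  have hf : Measurable fun w : ℝ × ℝ × Fin K => ENNReal.ofReal (Real.exp (-w.2.1)) := by fun_prop
  have hBκ (κ : Fin K) : MeasurableSet {z : ℝ × ℝ | (z.1, z.2, κ) ∈ B} := by
    exact (by fun_prop : Measurable fun z : ℝ × ℝ => (z.1, z.2, κ)) hB
  have hind (κ : Fin K) : Measurable fun z : ℝ × ℝ =>
      B.indicator (fun w => ENNReal.ofReal (Real.exp (-w.2.1))) (z.1, z.2, κ) :=
    (hf.indicator hB).comp (by fun_prop : Measurable fun z : ℝ × ℝ => (z.1, z.2, κ))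
  rw [sectionMeasure, withDensity_apply _ hB, Measure.restrict_restrict hB,
    inter_eq_self_of_subset_left hBσ, ← lintegral_indicator hB, sheetLebesgue,
    lintegral_prod _ (hf.indicator hB).aemeasurable]
  have h1 (s : ℝ) : ∫⁻ z : ℝ × Fin K, B.indicator (fun w => ENNReal.ofReal (Real.exp (-w.2.1)))
        (s, z) ∂((volume : Measure ℝ).prod Measure.count) =
      ∑ κ, ∫⁻ t, B.indicator (fun w => ENNReal.ofReal (Real.exp (-w.2.1))) (s, t, κ) := by
    have hs : Measurable fun z : ℝ × Fin K =>
        B.indicator (fun w => ENNReal.ofReal (Real.exp (-w.2.1))) (s, z) :=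
      (hf.indicator hB).comp measurable_prodMk_left
    rw [lintegral_prod _ hs.aemeasurable]
    simp only [lintegral_count, tsum_fintype]
    rw [lintegral_finsetSum]
    intro κ _
    exact (hind κ).comp measurable_prodMk_left
  simp_rw [h1]
  rw [lintegral_finsetSum]
  · refine Finset.sum_congr rfl fun κ _ => ?_
    rw [Measure.prod_apply (hBκ κ)]
    congr 1 with s
    rw [expMeasure, withDensity_apply _ (measurable_prodMk_left (hBκ κ)),
      ← lintegral_indicator (measurable_prodMk_left (hBκ κ))]
    rfl
  · intro κ _
    exact (hind κ).lintegral_prod_right'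

theorem prod_sectionMeasure_apply_eq_sum {K : ℕ} {σ : Fin K → ℝ} {A : Set (ℝ × ℝ × ℝ × Fin K)}
    (hA : MeasurableSet A) (hAσ : ∀ q ∈ A, q.2 ∈ paramDomain σ) :
    (volume : Measure ℝ).prod (sectionMeasure σ) A =
      ∑ κ, (volume : Measure ℝ).prod ((volume : Measure ℝ).prod expMeasure)
        {q | (q.1, q.2.1, q.2.2, κ) ∈ A} := by
  have hAκ (κ : Fin K) : MeasurableSet {q : ℝ × ℝ × ℝ | (q.1, q.2.1, q.2.2, κ) ∈ A} := by
    exact (by fun_prop : Measurable fun q : ℝ × ℝ × ℝ => (q.1, q.2.1, q.2.2, κ)) hA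
  rw [Measure.prod_apply hA]
  have h1 (r : ℝ) : sectionMeasure σ (Prod.mk r ⁻¹' A) =
      ∑ κ, (volume : Measure ℝ).prod expMeasure
        (Prod.mk r ⁻¹' {q : ℝ × ℝ × ℝ | (q.1, q.2.1, q.2.2, κ) ∈ A}) :=
    sectionMeasure_apply_eq_sum (measurable_prodMk_left hA) fun w hw => hAσ _ hw
  simp_rw [h1]
  rw [lintegral_finsetSum]
  · exact Finset.sum_congr rfl fun κ _ => (Measure.prod_apply (hAκ κ)).symm
  · exact fun κ _ => measurable_measure_prodMk_left (hAκ κ)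

/-- Injectivity on `B` makes its Γ-translates disjoint, so their intersections with the fundamental
domain reassemble to `B`. -/
theorem measure_image_toCoset {Γ : Subgroup SL2R} [Countable Γ] {m : Measure SL2R}
    [m.IsHaarMeasure] {F : Set SL2R} (hF : IsFundamentalDomain Γ F m) {B : Set SL2R}
    (hB : MeasurableSet B) (hinj : InjOn (toCoset Γ) B) (hE : MeasurableSet (toCoset Γ '' B)) :
    liouville Γ m F (toCoset Γ '' B) = m B := by
  have hmeas (γ : Γ) : MeasurableSet ((fun h => (γ : SL2R) * h) ⁻¹' B) :=
    (continuous_const_mul (γ : SL2R)).measurable hB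
  rw [liouville_apply hE, ← Measure.restrict_apply₀' hF.nullMeasurableSet, preimage_toCoset_image,
    measure_iUnion _ hmeas, hF.measure_eq_tsum B, ← (Equiv.inv Γ).tsum_eq]
  · refine tsum_congr fun γ => ?_
    rw [Measure.restrict_apply₀' hF.nullMeasurableSet]
    congr 2
    ext h
    rw [mem_smul_set_iff_inv_smul_mem]
    simp [Subgroup.smul_def]
  · intro γ γ' hne
    refine Set.disjoint_left.2 fun h h1 h2 => hne ?_
    have h3 : (γ : SL2R) * h = γ' * h :=
      hinj h1 h2 (by rw [toCoset_mul_left Γ γ.2, toCoset_mul_left Γ γ'.2])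
    exact Subtype.ext (mul_right_cancel h3)

/-! ### The flow box -/

section FlowBox

variable (Γ : Subgroup SL2R) {K : ℕ} (g : Fin K → SL2R) (σ : Fin K → ℝ)

/-- Lift of `flowBox` to `SL(2, ℝ)`. -/
def flowBoxLift (ε : ℝ) (q : ℝ × ℝ × ℝ × Fin K) : SL2R :=
  sectionPoint g q.2 * lowerMatrix (-(ε * q.1))

/-- The point from which the orbit `r ↦ h⁺_{ε r}` reaches the point with parameter `w` of the
section at time `r`, as a function of `(r, w)`. -/
def flowBox (ε : ℝ) (q : ℝ × ℝ × ℝ × Fin K) : CosetSpace Γ := toCoset Γ (flowBoxLift g ε q)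

/-- The set of `(r, w)` such that the section is not hit strictly before time `r` when starting at
the point with parameter `w` in the direction opposite to `ε`. -/
def boxDomain (ε : ℝ) : Set (ℝ × ℝ × ℝ × Fin K) :=
  {q | q.2 ∈ paramDomain σ ∧ 0 < q.1 ∧ ENNReal.ofReal q.1 ≤ firstHit Γ g σ (-ε) (param Γ g 0 q.2)}

theorem flowBox_eq (ε : ℝ) (q : ℝ × ℝ × ℝ × Fin K) :
    flowBox Γ g ε q = unstableFlow Γ (-(ε * q.1)) (param Γ g 0 q.2) := by
  rw [param_zero]
  rfl

theorem continuous_flowBoxLift (ε : ℝ) : Continuous (flowBoxLift g ε) := by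
  unfold flowBoxLift
  have := continuous_sectionPoint g
  fun_prop

theorem continuous_flowBox (ε : ℝ) : Continuous (flowBox Γ g ε) :=
  (continuous_toCoset Γ).comp (continuous_flowBoxLift g ε)

theorem flowBoxLift_eq_cell (ε : ℝ) (q : ℝ × ℝ × ℝ × Fin K) :
    flowBoxLift g ε q = g q.2.2.2 * cell (ε * q.1, q.2.1, q.2.2.1) := by
  simp [flowBoxLift, sectionPoint, cell, mul_assoc]

theorem image_flowBoxLift {ε : ℝ} (hε : ε * ε = 1) (A : Set (ℝ × ℝ × ℝ × Fin K)) :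
    flowBoxLift g ε '' A =
      ⋃ κ, (fun h => g κ * h) '' (cell '' {q | (ε * q.1, q.2.1, q.2.2, κ) ∈ A}) := by
  have hε' (r : ℝ) : ε * (ε * r) = r := by rw [← mul_assoc, hε, one_mul]
  ext h
  simp only [mem_image, mem_iUnion, exists_exists_and_eq_and, mem_ofPred_eq, flowBoxLift_eq_cell]
  constructor
  · rintro ⟨⟨r, s, t, κ⟩, hq, rfl⟩
    exact ⟨κ, (ε * r, s, t), by simpa only [hε'] using hq, rfl⟩
  · rintro ⟨κ, ⟨r, s, t⟩, hq, rfl⟩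
    exact ⟨_, hq, by simp only [hε']⟩

theorem isOpenMap_flowBox {ε : ℝ} (hε : ε * ε = 1) : IsOpenMap (flowBox Γ g ε) := by
  refine (isOpenMap_toCoset Γ).comp fun U hU => ?_
  rw [image_flowBoxLift g hε]
  refine isOpen_iUnion fun κ => (isOpenMap_mul_left (g κ)) _ (isOpenMap_cell _ ?_)
  exact hU.preimage (by fun_prop : Continuous fun q : ℝ × ℝ × ℝ => (ε * q.1, q.2.1, q.2.2, κ))

variable {Γ g σ}

theorem param_mem_multiSection {w : ℝ × ℝ × Fin K} (hw : w ∈ paramDomain σ) :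
    param Γ g 0 w ∈ multiSection Γ g σ 0 := by
  refine mem_iUnion.2 ⟨w.2.2, mem_iUnion₂.2 ⟨w.2.1 + 0, ?_, _, ⟨w.1, rfl⟩, rfl⟩⟩
  simpa using hw.2

theorem IsCuspSystem.exists_param_eq (hg : IsCuspSystem Γ g) {y : CosetSpace Γ}
    (hy : y ∈ multiSection Γ g σ 0) : ∃ w ∈ paramDomain σ, param Γ g 0 w = y := by
  obtain ⟨κ, hy⟩ := mem_iUnion.1 hy
  obtain ⟨t, ht, -, ⟨s, rfl⟩, rfl⟩ := mem_iUnion₂.1 hy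
  -- The horocycle has period one, so s may be reduced to its fractional part.
  refine ⟨(Int.fract s, t, κ), ⟨⟨Int.fract_nonneg s, Int.fract_lt_one s⟩, by simpa using ht⟩, ?_⟩
  simp only [param, add_zero]
  congr 1
  rw [stableFlow_toCoset, stableFlow_toCoset, toCoset_eq_iff]
  refine ⟨_, (hg.mul_upperMatrix_mem_iff κ ⌊s⌋).2 ⟨_, rfl⟩, ?_⟩
  rw [mul_assoc, inv_mul_cancel_left, mul_assoc, ← upperMatrix_add, Int.floor_add_fract]

/-- A hit at some r < q.1 would be, seen backwards from the section point, a return at time q.1 - r,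
earlier than the domain allows. -/
theorem isLeast_hitSet_flowBox {ε : ℝ} {q : ℝ × ℝ × ℝ × Fin K} (hq : q ∈ boxDomain Γ g σ ε) :
    IsLeast (hitSet Γ g σ ε (flowBox Γ g ε q)) q.1 := by
  obtain ⟨hw, h0, hle⟩ := hq
  rw [flowBox_eq]
  constructor
  · refine ⟨h0, ?_⟩
    rw [unstableFlow_unstableFlow, neg_add_cancel, unstableFlow_zero]
    exact param_mem_multiSection hw
  · rintro r ⟨hr, hhit⟩
    by_contra hlt
    have hlt := not_le.1 hlt
    have hmem : q.1 - r ∈ hitSet Γ g σ (-ε) (param Γ g 0 q.2) := by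
      refine ⟨sub_pos.2 hlt, ?_⟩
      rw [unstableFlow_unstableFlow] at hhit
      convert hhit using 2
      ring
    have := hle.trans (firstHit_le hmem)
    rw [ENNReal.ofReal_le_ofReal_iff (sub_pos.2 hlt).le] at this
    linarith

/-- Conversely, a return from the impact point in the reversed direction before time r would give an
earlier hit from x. -/
theorem flowBox_eq_of_isLeast {ε r : ℝ} {x : CosetSpace Γ}
    (h : IsLeast (hitSet Γ g σ ε x) r) {w : ℝ × ℝ × Fin K} (hw : w ∈ paramDomain σ)
    (hwx : param Γ g 0 w = unstableFlow Γ (ε * r) x) :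
    (r, w) ∈ boxDomain Γ g σ ε ∧ flowBox Γ g ε (r, w) = x := by
  obtain ⟨⟨h0, hhit⟩, hmin⟩ := h
  refine ⟨⟨hw, h0, le_iInf₂ fun r' hr' => ENNReal.ofReal_le_ofReal ?_⟩, ?_⟩
  · by_contra hlt
    have hlt := not_le.1 hlt
    have hmem : r - r' ∈ hitSet Γ g σ ε x := by
      refine ⟨sub_pos.2 hlt, ?_⟩
      have := hr'.2
      dsimp only at this
      rw [hwx, unstableFlow_unstableFlow] at this
      convert this using 2
      ring
    have := hmin hmem
    linarith [hr'.1]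
  · rw [flowBox_eq]
    dsimp only
    rw [hwx, unstableFlow_unstableFlow, add_neg_cancel, unstableFlow_zero]

theorem IsCuspSystem.injOn_flowBox (hg : IsCuspSystem Γ g) (ε : ℝ) :
    InjOn (flowBox Γ g ε) (boxDomain Γ g σ ε) := by
  intro q hq q' hq' h
  have h1 := isLeast_hitSet_flowBox hq
  have h2 := isLeast_hitSet_flowBox hq'
  rw [h] at h1
  have hr : q.1 = q'.1 := h1.unique h2
  refine Prod.ext hr (hg.injOn_param hq.1 hq'.1 ?_)
  have h3 := congrArg (unstableFlow Γ (ε * q.1)) h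
  rwa [flowBox_eq, flowBox_eq, ← hr, unstableFlow_unstableFlow, unstableFlow_unstableFlow,
    neg_add_cancel, unstableFlow_zero, unstableFlow_zero] at h3

theorem measurable_firstHit_param [DiscreteTopology Γ] (hg : IsCuspSystem Γ g) {ε : ℝ}
    (hε : ε * ε = 1) : Measurable fun w => firstHit Γ g σ ε (param Γ g 0 w) :=
  (lowerSemicontinuous_firstHit_param hg hε).measurable

theorem measurableSet_boxDomain [DiscreteTopology Γ] (hg : IsCuspSystem Γ g) {ε : ℝ}
    (hε : ε * ε = 1) : MeasurableSet (boxDomain Γ g σ ε) := by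
  have h1 : MeasurableSet {q : ℝ × ℝ × ℝ × Fin K | q.2 ∈ paramDomain σ} :=
    measurable_snd (measurableSet_paramDomain σ)
  have h2 : MeasurableSet {q : ℝ × ℝ × ℝ × Fin K | 0 < q.1} :=
    measurableSet_lt measurable_const measurable_fst
  have h3 : MeasurableSet {q : ℝ × ℝ × ℝ × Fin K |
      ENNReal.ofReal q.1 ≤ firstHit Γ g σ (-ε) (param Γ g 0 q.2)} :=
    measurableSet_le (by fun_prop)
      ((measurable_firstHit_param hg (by rwa [neg_mul_neg])).comp measurable_snd)
  exact h1.inter (h2.inter h3)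

theorem measurableSet_image_flowBox [DiscreteTopology Γ] (hg : IsCuspSystem Γ g) {ε : ℝ}
    {A : Set (ℝ × ℝ × ℝ × Fin K)} (hA : MeasurableSet A) (hAb : A ⊆ boxDomain Γ g σ ε) :
    MeasurableSet (flowBox Γ g ε '' A) :=
  have := t2Space_cosetSpace Γ
  hA.image_of_continuousOn_injOn (continuous_flowBox Γ g ε).continuousOn
    ((hg.injOn_flowBox ε).mono hAb)

/-- In the coordinates of the flow box, the Liouville measure is a multiple of `dr ⊗ ν_σ`. -/
theorem IsCuspSystem.exists_liouville_image_flowBox [DiscreteTopology Γ] (hg : IsCuspSystem Γ g)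
    {m : Measure SL2R} [m.IsHaarMeasure] {F : Set SL2R} (hF : IsFundamentalDomain Γ F m) :
    ∃ k : NNReal, ∀ ε : ℝ, ε * ε = 1 → ∀ A : Set (ℝ × ℝ × ℝ × Fin K), MeasurableSet A →
      A ⊆ boxDomain Γ g σ ε →
      liouville Γ m F (flowBox Γ g ε '' A) =
        k * (volume : Measure ℝ).prod (sectionMeasure σ) A := by
  have := countable_of_discrete Γ
  obtain ⟨k, hk⟩ := exists_comap_cell_eq m
  -- The constant comes from Haar measure alone and is therefore shared by both time directions. The
  -- final normalisation depends on this.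
  refine ⟨k, fun ε hε A hA hAb => ?_⟩
  have hinj : InjOn (toCoset Γ ∘ flowBoxLift g ε) A := (hg.injOn_flowBox ε).mono hAb
  have hlift : InjOn (flowBoxLift g ε) A := fun q hq q' hq' h =>
    hinj hq hq' (congrArg (toCoset Γ) h)
  have hB : MeasurableSet (flowBoxLift g ε '' A) :=
    hA.image_of_continuousOn_injOn (continuous_flowBoxLift g ε).continuousOn hlift
  have hE := measurableSet_image_flowBox hg hA hAb
  have himg : flowBox Γ g ε '' A = toCoset Γ '' (flowBoxLift g ε '' A) := by
    rw [image_image]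
    rfl
  have hAκ (κ : Fin K) : MeasurableSet {q : ℝ × ℝ × ℝ | (ε * q.1, q.2.1, q.2.2, κ) ∈ A} := by
    exact (by fun_prop : Measurable fun q : ℝ × ℝ × ℝ => (ε * q.1, q.2.1, q.2.2, κ)) hA
  rw [himg] at hE ⊢
  rw [measure_image_toCoset hF hB hinj.image_of_comp hE, image_flowBoxLift g hε,
    measure_iUnion, tsum_fintype, prod_sectionMeasure_apply_eq_sum hA fun q hq => (hAb hq).1,
    Finset.mul_sum]
  · refine Finset.sum_congr rfl fun κ _ => ?_
    rw [image_mul_left, measure_preimage_mul, ← measurableEmbedding_cell.comap_apply, hk]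
    have hflip : MeasurePreserving (fun q : ℝ × ℝ × ℝ => (ε * q.1, q.2))
        ((volume : Measure ℝ).prod ((volume : Measure ℝ).prod expMeasure))
        ((volume : Measure ℝ).prod ((volume : Measure ℝ).prod expMeasure)) := by
      have h1 : MeasurePreserving (fun r : ℝ => ε * r) volume volume := by
        rcases mul_self_eq_one_iff.1 hε with h | h
        · simp only [h, one_mul]
          exact MeasurePreserving.id _
        · simpa [h] using Measure.measurePreserving_neg (volume : Measure ℝ)
      exact h1.prod (MeasurePreserving.id _)
    have hAκ' : MeasurableSet {q : ℝ × ℝ × ℝ | (q.1, q.2.1, q.2.2, κ) ∈ A} := by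
      exact (by fun_prop : Measurable fun q : ℝ × ℝ × ℝ => (q.1, q.2.1, q.2.2, κ)) hA
    rw [← hflip.measure_preimage hAκ'.nullMeasurableSet]
    rfl
  · intro κ κ' hne
    refine Set.disjoint_left.2 ?_
    rintro _ ⟨_, ⟨q, hq, rfl⟩, rfl⟩ ⟨_, ⟨q', hq', rfl⟩, h⟩
    have hε' (r : ℝ) : ε * (ε * r) = r := by rw [← mul_assoc, hε, one_mul]
    have := hlift hq' hq (by
      rw [flowBoxLift_eq_cell, flowBoxLift_eq_cell]
      simpa only [hε'] using h)
    exact hne (congrArg (fun q : ℝ × ℝ × ℝ × Fin K => q.2.2.2) this).symm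
  · intro κ
    exact (Homeomorph.mulLeft (g κ)).measurableEmbedding.measurableSet_image.2
      (measurableEmbedding_cell.measurableSet_image.2 (hAκ κ))

/-- The flow box covers almost all of the quotient. -/
theorem IsCuspSystem.liouville_image_boxDomain [DiscreteTopology Γ] (hg : IsCuspSystem Γ g)
    (hneg : (-1 : SL2R) ∈ Γ) (hK : 0 < K) {m : Measure SL2R} [m.IsHaarMeasure] {F : Set SL2R}
    (hF : IsFundamentalDomain Γ F m) (hmF : m F = 1) {ε : ℝ} (hε : ε * ε = 1) :
    liouville Γ m F (flowBox Γ g ε '' boxDomain Γ g σ ε) = 1 := by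
  have hE := measurableSet_image_flowBox hg (measurableSet_boxDomain hg hε) (subset_refl
    (boxDomain Γ g σ ε))
  have hprob := isProbabilityMeasure_liouville (Γ := Γ) hmF
  rw [prob_compl_eq_zero_iff hE |>.symm, liouville,
    Measure.map_apply (continuous_toCoset Γ).measurable hE.compl]
  refine measure_mono_null ?_ (ae_iff.1 (ae_nonempty_hitSet hneg hF hmF hK g σ hε))
  intro h hh hne
  obtain ⟨r, hr⟩ := exists_isLeast_hitSet hg hε hne
  obtain ⟨w, hw, hwx⟩ := hg.exists_param_eq hr.1.2
  obtain ⟨h1, h2⟩ := flowBox_eq_of_isLeast hr hw hwx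
  exact hh ⟨_, h1, h2⟩

theorem volume_setOf_ofReal_le (η : ENNReal) :
    volume {r : ℝ | 0 < r ∧ ENNReal.ofReal r ≤ η} = η := by
  by_cases h : η = ⊤
  · have : {r : ℝ | 0 < r ∧ ENNReal.ofReal r ≤ η} = Ioi 0 := by
      ext r
      simp [h]
    rw [this, h, Real.volume_Ioi]
  · have : {r : ℝ | 0 < r ∧ ENNReal.ofReal r ≤ η} = Ioc 0 η.toReal := by
      ext r
      simp only [mem_ofPred_eq, mem_Ioc, and_congr_right_iff]
      intro _
      rw [ENNReal.ofReal_le_iff_le_toReal h]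
    rw [this, Real.volume_Ioc, sub_zero, ENNReal.ofReal_toReal h]

theorem prod_sectionMeasure_boxDomain [DiscreteTopology Γ] (hg : IsCuspSystem Γ g) {ε : ℝ}
    (hε : ε * ε = 1) :
    (volume : Measure ℝ).prod (sectionMeasure σ) (boxDomain Γ g σ ε) =
      ∫⁻ w, firstHit Γ g σ (-ε) (param Γ g 0 w) ∂(sectionMeasure σ) := by
  rw [Measure.prod_apply_symm (measurableSet_boxDomain hg hε)]
  refine lintegral_congr_ae ?_
  filter_upwards [ae_mem_paramDomain σ] with w hw
  rw [← volume_setOf_ofReal_le (firstHit Γ g σ (-ε) (param Γ g 0 w))]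
  congr 1
  ext r
  simp [boxDomain, hw]

/-- The set of `(r, w)` such that the section is hit strictly after time `r` when starting at
the point with parameter `w` in the direction opposite to `ε` is open. -/
theorem isOpen_lt_firstHit_param [DiscreteTopology Γ] (hg : IsCuspSystem Γ g) {ε : ℝ}
    (hε : ε * ε = 1) :
    IsOpen {q : ℝ × ℝ × ℝ × Fin K | ENNReal.ofReal q.1 < firstHit Γ g σ ε (param Γ g 0 q.2)} := by
  rw [isOpen_iff_mem_nhds]
  intro q hq
  have hq' : ENNReal.ofReal q.1 < firstHit Γ g σ ε (param Γ g 0 q.2) := hq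
  obtain ⟨c, hc1, hc2⟩ := exists_between hq'
  have h1 : ∀ᶠ q' : ℝ × ℝ × ℝ × Fin K in 𝓝 q, ENNReal.ofReal q'.1 < c := by
    have : Continuous fun q' : ℝ × ℝ × ℝ × Fin K => ENNReal.ofReal q'.1 :=
      ENNReal.continuous_ofReal.comp continuous_fst
    exact (this.tendsto q).eventually_lt_const hc1
  have h2 : ∀ᶠ q' : ℝ × ℝ × ℝ × Fin K in 𝓝 q, c < firstHit Γ g σ ε (param Γ g 0 q'.2) :=
    (continuous_snd.tendsto q).eventually (lowerSemicontinuous_firstHit_param hg hε q.2 c hc2)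
  filter_upwards [h1, h2] with q' h1 h2 using h1.trans h2

end FlowBox

/-! ### Renormalisation by the geodesic flow -/

section Renormalisation

variable (Γ : Subgroup SL2R) {K : ℕ} (g : Fin K → SL2R) (σ : Fin K → ℝ) (R : ℝ)

theorem geodesicFlow_add (s t : ℝ) (x : CosetSpace Γ) :
    geodesicFlow Γ (s + t) x = geodesicFlow Γ t (geodesicFlow Γ s x) := by
  simp only [geodesicFlow, rightTranslate_rightTranslate, diagMatrix_add]

theorem geodesicFlow_injective (t : ℝ) : Function.Injective (geodesicFlow Γ t) :=
  Function.LeftInverse.injective (geodesicFlow_neg_geodesicFlow Γ t)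

theorem param_eq_geodesicFlow (w : ℝ × ℝ × Fin K) :
    param Γ g R w = geodesicFlow Γ R (param Γ g 0 w) := by
  simp only [param, add_zero, geodesicFlow_add]

theorem geodesicFlow_mem_multiSection_iff (y : CosetSpace Γ) :
    geodesicFlow Γ R y ∈ multiSection Γ g σ R ↔ y ∈ multiSection Γ g σ 0 := by
  simp only [multiSection, cuspSection, mem_iUnion, mem_image, mem_Ici, exists_prop, add_zero]
  refine exists_congr fun κ => ⟨?_, ?_⟩
  · rintro ⟨t, ht, x, hx, h⟩
    refine ⟨t - R, by linarith, x, hx, geodesicFlow_injective Γ R ?_⟩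
    rw [← geodesicFlow_add, sub_add_cancel, h]
  · rintro ⟨t, ht, x, hx, rfl⟩
    exact ⟨t + R, by linarith, x, hx, geodesicFlow_add Γ t R x⟩

/-- Commuting `φ_R` past the unstable flow contracts time by `e^{-R}`, and `φ_R` carries H(σ,0) onto
H(σ,R). -/
theorem exp_neg_mul_hittingTime (y : CosetSpace Γ) :
    ENNReal.ofReal (Real.exp (-R)) * hittingTime Γ g σ R (geodesicFlow Γ R y) =
      hittingTime Γ g σ 0 y := by
  have h0 : ENNReal.ofReal (Real.exp (-R)) ≠ 0 := by
    simpa using Real.exp_pos (-R)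
  simp only [hittingTime, ENNReal.mul_iInf_of_ne h0 ENNReal.ofReal_ne_top,
    ← ENNReal.ofReal_mul (Real.exp_pos (-R)).le, unstableFlow_geodesicFlow,
    geodesicFlow_mem_multiSection_iff]
  refine le_antisymm (le_iInf₂ fun r hr => ?_) (le_iInf₂ fun r hr => ?_)
  · have e : Real.exp (-R) * (Real.exp R * r) = r := by
      rw [← mul_assoc, ← Real.exp_add, neg_add_cancel, Real.exp_zero, one_mul]
    refine (iInf₂_le (Real.exp R * r) ⟨mul_pos (Real.exp_pos _) hr.1, ?_⟩).trans_eq (by rw [e])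
    rw [e]
    exact hr.2
  · exact iInf₂_le (Real.exp (-R) * r) ⟨mul_pos (Real.exp_pos _) hr.1, hr.2⟩

theorem isFirstImpact_geodesicFlow_iff (y : CosetSpace Γ) (w : ℝ × ℝ × Fin K) :
    IsFirstImpact Γ g σ R (geodesicFlow Γ R y) w ↔ IsFirstImpact Γ g σ 0 y w := by
  have h := exp_neg_mul_hittingTime Γ g σ R y
  have hpos := Real.exp_pos (-R)
  have h1 : hittingTime Γ g σ R (geodesicFlow Γ R y) ≠ ⊤ ↔ hittingTime Γ g σ 0 y ≠ ⊤ := by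
    rw [← h, ne_eq, ne_eq, ENNReal.mul_eq_top]
    simp [hpos]
  have h2 : Real.exp (-R) * (hittingTime Γ g σ R (geodesicFlow Γ R y)).toReal =
      (hittingTime Γ g σ 0 y).toReal := by
    rw [← h, ENNReal.toReal_mul, ENNReal.toReal_ofReal hpos.le]
  unfold IsFirstImpact
  rw [h1, param_eq_geodesicFlow, unstableFlow_geodesicFlow, h2,
    (geodesicFlow_injective Γ R).eq_iff]

/-- The set of initial points with first hit after time `X` and impact parameter in `D`. -/
def impactSet (X : ℝ) (D : Set (ℝ × ℝ × Fin K)) : Set (CosetSpace Γ) :=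
  {x | ENNReal.ofReal X < hittingTime Γ g σ 0 x ∧ ∃ w ∈ D, IsFirstImpact Γ g σ 0 x w}

theorem setOf_firstImpact_eq_image (X : ℝ) (D : Set (ℝ × ℝ × Fin K)) :
    {x : CosetSpace Γ |
      ENNReal.ofReal X < ENNReal.ofReal (Real.exp (-R)) * hittingTime Γ g σ R x ∧
      ∃ w ∈ D, IsFirstImpact Γ g σ R x w} = geodesicFlow Γ R '' impactSet Γ g σ X D := by
  ext x
  constructor
  · intro hx
    refine ⟨geodesicFlow Γ (-R) x, ?_, geodesicFlow_geodesicFlow_neg Γ R x⟩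
    rw [← geodesicFlow_geodesicFlow_neg Γ R x] at hx
    simpa only [impactSet, mem_ofPred_eq, exp_neg_mul_hittingTime, isFirstImpact_geodesicFlow_iff] using hx
  · rintro ⟨y, hy, rfl⟩
    simpa only [impactSet, mem_ofPred_eq, exp_neg_mul_hittingTime, isFirstImpact_geodesicFlow_iff] using hy

end Renormalisation

/-! ### The impact set -/

section Impact

variable {Γ : Subgroup SL2R} {K : ℕ} {g : Fin K → SL2R} {σ : Fin K → ℝ}

variable (Γ g σ) in
/-- The flow box coordinates of the impact set. -/
def impactBox (X : ℝ) (D : Set (ℝ × ℝ × Fin K)) : Set (ℝ × ℝ × ℝ × Fin K) :=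
  {q ∈ boxDomain Γ g σ 1 | q.2 ∈ D ∧ X < q.1}

theorem impactSet_eq_image {X : ℝ} (hX : 0 < X) {D : Set (ℝ × ℝ × Fin K)} :
    impactSet Γ g σ X D = flowBox Γ g 1 '' impactBox Γ g σ X D := by
  ext x
  constructor
  · rintro ⟨hXx, w, hwD, hfin, hw, hwx⟩
    rw [ENNReal.ofReal_lt_iff_lt_toReal hX.le hfin] at hXx
    set r := (hittingTime Γ g σ 0 x).toReal with hr
    have hleast : IsLeast (hitSet Γ g σ 1 x) r := by
      refine ⟨⟨hX.trans hXx, ?_⟩, fun r' hr' => ?_⟩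
      · rw [one_mul, ← hwx]
        exact param_mem_multiSection hw
      · rw [hr, hittingTime_eq_firstHit]
        exact ENNReal.toReal_le_of_le_ofReal hr'.1.le (firstHit_le hr')
    obtain ⟨h1, h2⟩ := flowBox_eq_of_isLeast hleast hw (by rw [one_mul, hwx])
    exact ⟨(r, w), ⟨h1, hwD, hXx⟩, h2⟩
  · rintro ⟨q, ⟨hq, hqD, hXq⟩, rfl⟩
    have hleast := isLeast_hitSet_flowBox hq
    have hr := firstHit_eq_of_isLeast hleast
    rw [← hittingTime_eq_firstHit] at hr
    refine ⟨?_, q.2, hqD, ?_, hq.1, ?_⟩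
    · rw [hr]
      exact (ENNReal.ofReal_lt_ofReal_iff (hX.trans hXq)).2 hXq
    · rw [hr]
      exact ENNReal.ofReal_ne_top
    · rw [hr, ENNReal.toReal_ofReal (hX.trans hXq).le, flowBox_eq, unstableFlow_unstableFlow,
        one_mul, neg_add_cancel, unstableFlow_zero]

theorem measurableSet_impactBox [DiscreteTopology Γ] (hg : IsCuspSystem Γ g) {X : ℝ}
    {D : Set (ℝ × ℝ × Fin K)} (hD : MeasurableSet D) : MeasurableSet (impactBox Γ g σ X D) :=
  (measurableSet_boxDomain hg (one_mul 1)).inter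
    ((measurable_snd hD).inter (measurableSet_lt measurable_const measurable_fst))

/-- The graph of the return time is a null set. -/
theorem prod_sectionMeasure_graph_eq_zero [DiscreteTopology Γ] (hg : IsCuspSystem Γ g) {ε : ℝ}
    (hε : ε * ε = 1) :
    (volume : Measure ℝ).prod (sectionMeasure σ)
      {q | 0 < q.1 ∧ ENNReal.ofReal q.1 = firstHit Γ g σ ε (param Γ g 0 q.2)} = 0 := by
  have hmeas : MeasurableSet {q : ℝ × ℝ × ℝ × Fin K |
      0 < q.1 ∧ ENNReal.ofReal q.1 = firstHit Γ g σ ε (param Γ g 0 q.2)} :=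
    (measurableSet_lt measurable_const measurable_fst).inter
      (measurableSet_eq_fun (by fun_prop) ((measurable_firstHit_param hg hε).comp measurable_snd))
  rw [Measure.prod_apply_symm hmeas, lintegral_eq_zero_iff (measurable_measure_prodMk_right hmeas)]
  refine Eventually.of_forall fun w => ?_
  refine measure_mono_null ?_
    (measure_singleton (μ := volume) (firstHit Γ g σ ε (param Γ g 0 w)).toReal)
  rintro r ⟨h0, hr⟩
  dsimp only at h0 hr
  rw [mem_singleton_iff, ← hr, ENNReal.toReal_ofReal h0.le]

theorem isOpen_interior_paramDomain (σ : Fin K → ℝ) :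
    IsOpen {w : ℝ × ℝ × Fin K | w.1 ∈ Ioo (0 : ℝ) 1 ∧ σ w.2.2 < w.2.1} := by
  have hσ : Continuous σ := continuous_of_discreteTopology
  exact (isOpen_Ioo.preimage continuous_fst).inter 
    (isOpen_lt (hσ.comp continuous_snd.snd) continuous_snd.fst)

theorem sectionMeasure_paramDomain_sdiff (σ : Fin K → ℝ) :
    sectionMeasure σ
      (paramDomain σ \ {w | w.1 ∈ Ioo (0 : ℝ) 1 ∧ σ w.2.2 < w.2.1}) = 0 := by
  apply sectionMeasure_absolutelyContinuous σ
  have h1 : sheetLebesgue K (Prod.fst ⁻¹' {0}) = 0 :=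
    Measure.quasiMeasurePreserving_fst.preimage_null (measure_singleton _)
  have h2 (κ : Fin K) : sheetLebesgue K (Prod.snd ⁻¹' (Prod.fst ⁻¹' {σ κ})) = 0 :=
    Measure.quasiMeasurePreserving_snd.preimage_null
      (Measure.quasiMeasurePreserving_fst.preimage_null (measure_singleton _))
  refine measure_mono_null ?_ (measure_union_null h1 (measure_iUnion_null h2))
  rintro w ⟨⟨hs, ht⟩, hn⟩
  by_contra hcon
  simp only [mem_union, mem_preimage, mem_singleton_iff, mem_iUnion, not_or, not_exists] at hcon
  exact hn ⟨⟨lt_of_le_of_ne hs.1 (Ne.symm hcon.1), hs.2⟩,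
    lt_of_le_of_ne ht (Ne.symm (hcon.2 _))⟩

/-- The boundary of the impact set is a null set. -/
theorem liouville_frontier_impactSet [DiscreteTopology Γ] (hg : IsCuspSystem Γ g)
    (hneg : (-1 : SL2R) ∈ Γ) (hK : 0 < K) {m : Measure SL2R} [m.IsHaarMeasure] {F : Set SL2R}
    (hF : IsFundamentalDomain Γ F m) (hmF : m F = 1) {X : ℝ} (hX : 0 < X)
    {D : Set (ℝ × ℝ × Fin K)} (hDσ : D ⊆ paramDomain σ) (hD0 : sheetLebesgue K (frontier D) = 0) :
    liouville Γ m F (frontier (impactSet Γ g σ X D)) = 0 := by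
  have hε : (1 : ℝ) * 1 = 1 := one_mul 1
  have hε' : (-1 : ℝ) * -1 = 1 := by norm_num
  have hprob := isProbabilityMeasure_liouville (Γ := Γ) hmF
  have hopen := isOpen_lt_firstHit_param (σ := σ) hg hε'
  let G := {q : ℝ × ℝ × ℝ × Fin K |
    ENNReal.ofReal q.1 < firstHit Γ g σ (-1) (param Γ g 0 q.2)}
  let W := {w : ℝ × ℝ × Fin K | w.1 ∈ Ioo (0 : ℝ) 1 ∧ σ w.2.2 < w.2.1}
  have hWσ : W ⊆ paramDomain σ := fun w hw => ⟨Ioo_subset_Ico_self hw.1, hw.2.le⟩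
  have hW : IsOpen W := isOpen_interior_paramDomain σ
  -- `A₁` and `A₂` are open boxes whose images lie in the impact set and in its complement
  -- respectively. They are open because r < η₋₁(w) is an open condition, and the flow box map is
  -- open, so both images avoid the frontier.
  let A₁ : Set (ℝ × ℝ × ℝ × Fin K) := Prod.snd ⁻¹' interior D ∩ (Prod.fst ⁻¹' Ioi X ∩ G)
  let A₂ : Set (ℝ × ℝ × ℝ × Fin K) := Prod.snd ⁻¹' W ∩ (Prod.fst ⁻¹' Ioi 0 ∩ (G ∩
    (Prod.fst ⁻¹' Iio X ∪ Prod.snd ⁻¹' interior Dᶜ)))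
  have hA₁o : IsOpen A₁ := (isOpen_interior.preimage continuous_snd).inter
    ((isOpen_Ioi.preimage continuous_fst).inter hopen)
  have hA₂o : IsOpen A₂ := (hW.preimage continuous_snd).inter
    ((isOpen_Ioi.preimage continuous_fst).inter (hopen.inter
      ((isOpen_Iio.preimage continuous_fst).union (isOpen_interior.preimage continuous_snd))))
  have hA₁ : A₁ ⊆ impactBox Γ g σ X D := fun q hq =>
    ⟨⟨hDσ (interior_subset hq.1), hX.trans hq.2.1, le_of_lt hq.2.2⟩, interior_subset hq.1, hq.2.1⟩
  have hA₂ : A₂ ⊆ boxDomain Γ g σ 1 := fun q hq => ⟨hWσ hq.1, hq.2.1, le_of_lt hq.2.2.1⟩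
  have hA₂' : Disjoint A₂ (impactBox Γ g σ X D) := by
    refine Set.disjoint_left.2 fun q hq hq' => ?_
    rcases hq.2.2.2 with h | h
    · exact lt_asymm hq'.2.2 h
    · exact interior_subset h hq'.2.1
  have hE : impactSet Γ g σ X D = flowBox Γ g 1 '' impactBox Γ g σ X D := impactSet_eq_image hX
  have hin : flowBox Γ g 1 '' A₁ ⊆ interior (impactSet Γ g σ X D) :=
    interior_maximal (hE ▸ image_mono hA₁) (isOpenMap_flowBox Γ g hε _ hA₁o)
  have hout : flowBox Γ g 1 '' A₂ ⊆ interior (impactSet Γ g σ X D)ᶜ := by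
    refine interior_maximal ?_ (isOpenMap_flowBox Γ g hε _ hA₂o)
    rw [hE, subset_compl_iff_disjoint_right]
    refine Set.disjoint_left.2 ?_
    rintro _ ⟨q, hq, rfl⟩ ⟨q', hq', h⟩
    have := hg.injOn_flowBox 1 hq'.1 (hA₂ hq) h
    exact Set.disjoint_left.1 hA₂' hq (this ▸ hq')
  have hbox := measurableSet_boxDomain (σ := σ) hg hε
  have hboxm := measurableSet_image_flowBox hg hbox (subset_refl (boxDomain Γ g σ 1))
  let A₃ := boxDomain Γ g σ 1 \ (A₁ ∪ A₂)
  have hA₃m : MeasurableSet A₃ := hbox.diff (hA₁o.union hA₂o).measurableSet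
  -- The rest of the box lies over four null sets: the graph r = η₋₁(w), the edges of the sheets,
  -- the slice r = X and the frontier of `D`.
  have hA₃ : (volume : Measure ℝ).prod (sectionMeasure σ) A₃ = 0 := by
    have n1 := prod_sectionMeasure_graph_eq_zero (σ := σ) hg hε'
    have n2 : (volume : Measure ℝ).prod (sectionMeasure σ)
        (Prod.snd ⁻¹' (paramDomain σ \ W)) = 0 :=
      Measure.quasiMeasurePreserving_snd.preimage_null (sectionMeasure_paramDomain_sdiff σ)
    have n3 : (volume : Measure ℝ).prod (sectionMeasure σ) (Prod.fst ⁻¹' {X}) = 0 :=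
      Measure.quasiMeasurePreserving_fst.preimage_null (measure_singleton _)
    have n4 : (volume : Measure ℝ).prod (sectionMeasure σ) (Prod.snd ⁻¹' frontier D) = 0 :=
      Measure.quasiMeasurePreserving_snd.preimage_null (sectionMeasure_absolutelyContinuous σ hD0)
    refine measure_mono_null ?_
      (measure_union_null n1 (measure_union_null n2 (measure_union_null n3 n4)))
    rintro q ⟨⟨hw, h0, hle⟩, hn⟩
    by_contra hcon
    simp only [mem_union, not_or] at hcon
    obtain ⟨c1, c2, c3, c4⟩ := hcon
    have hqG : q ∈ G := lt_of_le_of_ne hle fun h => c1 ⟨h0, h⟩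
    have hqW : q.2 ∈ W := by
      by_contra h
      exact c2 ⟨hw, h⟩
    have hne : q.1 ≠ X := c3
    apply hn
    rcases lt_or_gt_of_ne hne with hlt | hgt
    · exact Or.inr ⟨hqW, h0, hqG, Or.inl hlt⟩
    · by_cases hD : q.2 ∈ interior D
      · exact Or.inl ⟨hD, hgt, hqG⟩
      · refine Or.inr ⟨hqW, h0, hqG, Or.inr ?_⟩
        change q.2 ∈ interior Dᶜ
        rw [interior_compl]
        exact fun hc => c4 ⟨hc, hD⟩
  obtain ⟨k, hk⟩ := hg.exists_liouville_image_flowBox (σ := σ) hF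
  have hnull₃ : liouville Γ m F (flowBox Γ g 1 '' A₃) = 0 := by
    rw [hk 1 hε A₃ hA₃m sdiff_subset, hA₃, mul_zero]
  have hnull₄ : liouville Γ m F (flowBox Γ g 1 '' boxDomain Γ g σ 1)ᶜ = 0 := by
    rw [prob_compl_eq_zero_iff hboxm]
    exact hg.liouville_image_boxDomain hneg hK hF hmF hε
  refine measure_mono_null ?_ (measure_union_null hnull₃ hnull₄)
  intro x hx
  by_cases hxb : x ∈ flowBox Γ g 1 '' boxDomain Γ g σ 1
  · obtain ⟨q, hq, rfl⟩ := hxb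
    refine Or.inl ⟨q, ⟨hq, ?_⟩, rfl⟩
    rintro (h1 | h2)
    · exact hx.2 (hin ⟨q, h1, rfl⟩)
    · have := hout ⟨q, h2, rfl⟩
      rw [interior_compl] at this
      exact this hx.1
  · exact Or.inr hxb

/-! ### The limit density -/

theorem backwardReturnTime_eq_firstHit (w : ℝ × ℝ × Fin K) :
    backwardReturnTime Γ g σ w = firstHit Γ g σ (-1) (param Γ g 0 w) :=
  backwardHittingTime_eq_firstHit Γ g σ _

theorem limitDensity_eq_indicator (q : ℝ × ℝ × ℝ × Fin K) :
    limitDensity Γ g σ q.1 q.2 =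
      {q : ℝ × ℝ × ℝ × Fin K | ENNReal.ofReal q.1 <
        firstHit Γ g σ (-1) (param Γ g 0 q.2)}.indicator
          (fun _ => 1 / (meanReturnTime Γ g σ).toReal) q := by
  simp only [limitDensity, backwardReturnTime_eq_firstHit, indicator, mem_ofPred_eq]

/-- The density has r < η₋₁ where the flow box has r ≤ η₋₁. The two sets differ by the graph of η₋₁,
which is null. -/
theorem prod_restrict_lt_firstHit [DiscreteTopology Γ] (hg : IsCuspSystem Γ g) {X : ℝ}
    (hX : 0 ≤ X) {D : Set (ℝ × ℝ × Fin K)} (hDσ : D ⊆ paramDomain σ) :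
    ((volume : Measure ℝ).restrict (Ioi X)).prod ((sectionMeasure σ).restrict D)
      {q | ENNReal.ofReal q.1 < firstHit Γ g σ (-1) (param Γ g 0 q.2)} =
    (volume : Measure ℝ).prod (sectionMeasure σ) (impactBox Γ g σ X D) := by
  have hε' : (-1 : ℝ) * -1 = 1 := by norm_num
  rw [Measure.prod_restrict, Measure.restrict_apply
    (isOpen_lt_firstHit_param hg hε').measurableSet]
  apply measure_congr
  have hnull := prod_sectionMeasure_graph_eq_zero (σ := σ) hg hε'
  filter_upwards [compl_mem_ae_iff.2 hnull] with q hq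
  apply propext
  constructor
  · rintro ⟨h1, h2, h3⟩
    exact ⟨⟨hDσ h3, hX.trans_lt h2, le_of_lt h1⟩, h3, h2⟩
  · rintro ⟨⟨-, h2, h3⟩, h4, h5⟩
    exact ⟨lt_of_le_of_ne h3 fun h => hq ⟨h2, h⟩, h5, h4⟩

/-- The limit density restricted to a product set is integrable, and its integral is the measure of
the corresponding impact set. -/
theorem integrable_and_integral_limitDensity [DiscreteTopology Γ] (hg : IsCuspSystem Γ g)
    {X : ℝ} (hX : 0 ≤ X) {D : Set (ℝ × ℝ × Fin K)} (hDσ : D ⊆ paramDomain σ)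
    (hfin : (volume : Measure ℝ).prod (sectionMeasure σ) (impactBox Γ g σ X D) ≠ ⊤) :
    Integrable (fun q : ℝ × (ℝ × ℝ × Fin K) => limitDensity Γ g σ q.1 q.2)
      (((volume : Measure ℝ).restrict (Ioi X)).prod ((sectionMeasure σ).restrict D)) ∧
    ∫ q : ℝ × (ℝ × ℝ × Fin K), limitDensity Γ g σ q.1 q.2
      ∂(((volume : Measure ℝ).restrict (Ioi X)).prod ((sectionMeasure σ).restrict D)) =
      ((volume : Measure ℝ).prod (sectionMeasure σ) (impactBox Γ g σ X D)).toReal *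
        (1 / (meanReturnTime Γ g σ).toReal) := by
  have hε' : (-1 : ℝ) * -1 = 1 := by norm_num
  have hG := (isOpen_lt_firstHit_param (σ := σ) hg hε').measurableSet
  simp only [limitDensity_eq_indicator]
  rw [← prod_restrict_lt_firstHit hg hX hDσ] at hfin ⊢
  refine ⟨(integrable_indicator_iff hG).2 (integrableOn_const hfin), ?_⟩
  rw [integral_indicator_const _ hG]
  rfl

end Impact

end CuspHitting

end

/-! ### The limit law -/

theorem mainTheorem6
    (Γ : Subgroup CuspHitting.SL2R) (hdisc : DiscreteTopology Γ)
    (hneg : (-1 : CuspHitting.SL2R) ∈ Γ)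
    (m : MeasureTheory.Measure CuspHitting.SL2R) (hm : m.IsHaarMeasure)
    (F : Set CuspHitting.SL2R) (hF : MeasureTheory.IsFundamentalDomain Γ F m) (hmF : m F = 1)
    (K : ℕ) (hK : 0 < K)
    (g : Fin K → CuspHitting.SL2R) (hg : CuspHitting.IsCuspSystem Γ g)
    (lam : MeasureTheory.Measure (CuspHitting.CosetSpace Γ))
    (hlam : MeasureTheory.IsProbabilityMeasure lam)
    (hadm : CuspHitting.IsAdmissible Γ (CuspHitting.liouville Γ m F) lam)
    (σ : Fin K → ℝ) :
    (MeasureTheory.Integrable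
        (fun p : ℝ × (ℝ × ℝ × Fin K) => CuspHitting.limitDensity Γ g σ p.1 p.2)
        ((MeasureTheory.volume.restrict (Set.Ioi (0 : ℝ))).prod (CuspHitting.sectionMeasure σ)) ∧
      ∫ p : ℝ × (ℝ × ℝ × Fin K), CuspHitting.limitDensity Γ g σ p.1 p.2
        ∂((MeasureTheory.volume.restrict (Set.Ioi (0 : ℝ))).prod
          (CuspHitting.sectionMeasure σ)) = 1) ∧
    ∀ X : ℝ, 0 < X → ∀ D : Set (ℝ × ℝ × Fin K), D ⊆ CuspHitting.paramDomain σ →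
      MeasurableSet D → CuspHitting.sheetLebesgue K (frontier D) = 0 →
      Filter.Tendsto
        (fun R : ℝ => lam.real {x : CuspHitting.CosetSpace Γ |
          ENNReal.ofReal X < ENNReal.ofReal (Real.exp (-R)) * CuspHitting.hittingTime Γ g σ R x ∧
          ∃ w ∈ D, CuspHitting.IsFirstImpact Γ g σ R x w})
        Filter.atTop
        (nhds (∫ r in Set.Ioi X, ∫ w in D,
          CuspHitting.limitDensity Γ g σ r w ∂(CuspHitting.sectionMeasure σ))) := by
  open CuspHitting MeasureTheory in
  have hε : (1 : ℝ) * 1 = 1 := one_mul 1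
  have hε' : (-1 : ℝ) * -1 = 1 := by norm_num
  have hprob := isProbabilityMeasure_liouville (Γ := Γ) hmF
  obtain ⟨k, hk⟩ := hg.exists_liouville_image_flowBox (σ := σ) hF
  have hforward : k * (volume : Measure ℝ).prod (sectionMeasure σ) (boxDomain Γ g σ 1) = 1 := by
    rw [← hk 1 hε _ (measurableSet_boxDomain hg hε) subset_rfl]
    exact hg.liouville_image_boxDomain hneg hK hF hmF hε
  -- The box with `ε = -1` lies under the graph of the forward return time η₁, and it also has full
  -- Liouville measure. Thus k, already tied to η₋₁ by `hforward`, is the reciprocal of the mean of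
  -- η₁.
  have hmean : k * meanReturnTime Γ g σ = 1 := by
    have h1 := hg.liouville_image_boxDomain (σ := σ) hneg hK hF hmF hε'
    rw [hk (-1) hε' _ (measurableSet_boxDomain hg hε') subset_rfl,
      prod_sectionMeasure_boxDomain hg hε', neg_neg] at h1
    simpa only [meanReturnTime, returnTime, hittingTime_eq_firstHit] using h1
  have hk0 : (k : ENNReal) ≠ 0 := fun h => by simp [h] at hmean
  have hkinv : 1 / (meanReturnTime Γ g σ).toReal = k := by
    have h1 := congrArg ENNReal.toReal hmean
    rw [ENNReal.toReal_mul, ENNReal.coe_toReal, ENNReal.toReal_one] at h1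
    exact (eq_one_div_of_mul_eq_one_left h1).symm
  have hfin : (volume : Measure ℝ).prod (sectionMeasure σ) (boxDomain Γ g σ 1) ≠ ⊤ := fun h => by
    rw [h, ENNReal.mul_top hk0] at hforward
    exact ENNReal.top_ne_one hforward
  have hsub (X : ℝ) (D : Set (ℝ × ℝ × Fin K)) :
      (volume : Measure ℝ).prod (sectionMeasure σ) (impactBox Γ g σ X D) ≠ ⊤ :=
    measure_ne_top_of_subset (Set.sep_subset _ _) hfin
  refine ⟨?_, fun X hX D hDσ hD hD0 => ?_⟩
  · have h := integrable_and_integral_limitDensity hg le_rfl (subset_refl (paramDomain σ))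
      (hsub 0 _)
    rw [Measure.restrict_eq_self_of_ae_mem (ae_mem_paramDomain σ)] at h
    refine ⟨h.1, h.2.trans ?_⟩
    have hbox : impactBox Γ g σ 0 (paramDomain σ) = boxDomain Γ g σ 1 :=
      Set.Subset.antisymm (Set.sep_subset _ _) fun q hq => ⟨hq, hq.1, hq.2.1⟩
    rw [hbox, hkinv, mul_comm, ← ENNReal.coe_toReal, ← ENNReal.toReal_mul, hforward,
      ENNReal.toReal_one]
  · have h := integrable_and_integral_limitDensity hg hX.le hDσ (hsub X D)
    have hE := impactSet_eq_image (Γ := Γ) (g := g) (σ := σ) hX (D := D)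
    have hAm := measurableSet_impactBox (σ := σ) hg (X := X) hD
    have hAb : impactBox Γ g σ X D ⊆ boxDomain Γ g σ 1 := Set.sep_subset _ _
    have hlim := hadm (impactSet Γ g σ X D) (hE ▸ measurableSet_image_flowBox hg hAm hAb)
      (liouville_frontier_impactSet hg hneg hK hF hmF hX hDσ hD0)
    -- Fubini turns the iterated integral into k times the measure of the impact box, which is the
    -- Liouville measure of the impact set.
    have hval : ∫ r in Set.Ioi X, ∫ w in D, limitDensity Γ g σ r w ∂(sectionMeasure σ) =
        (liouville Γ m F (impactSet Γ g σ X D)).toReal := by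
      rw [← integral_prod _ h.1, h.2, hE, hk 1 hε _ hAm hAb, hkinv, ENNReal.toReal_mul,
        ENNReal.coe_toReal, mul_comm]
    rw [hval]
    simp only [setOf_firstImpact_eq_image]
    exact (ENNReal.tendsto_toReal (measure_ne_top _ _)).comp hlim
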